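/- Let $\mathbb D=\{z\in\mathbb C:|z|<1\}$, let $\mathrm{Hol}(\mathbb D)$ be the space of analytic functions in $\mathbb D$, and let $dA=\frac1\pi\,dx\,dy$. For $1<p<\infty$ the analytic Besov space $B^p$ consists of those $f\in\mathrm{Hol}(\mathbb D)$ with $$(p-1)\int_{\mathbb D}(1-|z|)^{p-2}|f'(z)|^p\,dA(z)<\infty .$$ The Bloch space $\mathcal B$ consists of those $f\in\mathrm{Hol}(\mathbb D)$ with $\sup_{z\in\mathbb D}(1-|z|^2)|f'(z)|<\infty$; $H^\infty$ is the space of bounded functions in $\mathrm{Hol}(\mathbb D)$; and, for $\alpha>0$, the $\alpha$-logarithmic Bloch space $\mathcal B_{\log,\alpha}$ consists of those $f\in\mathrm{Hol}(\mathbb D)$ with $$\sup_{z\in\mathbb D}(1-|z|^2)\Bigl(\log\frac{2}{1-|z|^2}\Bigr)^{\alpha}|f'(z)|<\infty .$$ For $f,g\in\mathrm{Hol}(\mathbb D)$ and $z\in\mathbb D$ put $$T_g(f)(z)=\int_0^z g'(\xi)f(\xi)\,d\xi,\qquad I_g(f)(z)=\int_0^z g(\xi)f'(\xi)\,d\xi,\qquad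 M_g(f)(z)=g(z)f(z).$$ **Theorem.** Suppose that $1<p<\infty$, $\frac1p+\frac1{p'}=1$, and let $g\in\mathrm{Hol}(\mathbb D)$. Then: (i) $I_g$ maps $B^p$ into $\mathcal B$ if and only if $g\in H^\infty$. (ii) $M_g$ maps $B^p$ into $\mathcal B$ if and only if $g\in H^\infty\cap\mathcal B_{\log,1/p'}$. (iii) $T_g$ maps $B^p$ into $\mathcal B$ if and only if $g\in\mathcal B_{\log,1/p'}$. -/

import Mathlib

open MeasureTheory Set

noncomputable section

/-- The open unit disc `𝔻 = {z : |z| < 1}` of the complex plane. -/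
def unitDisk : Set ℂ := Metric.ball 0 1

/-- `Hol(𝔻)`: the functions that are analytic in the unit disc (the values that they take
outside the disc play no role). -/
def HolDisk : Set (ℂ → ℂ) := {f | DifferentiableOn ℂ f unitDisk}

/-- The normalized area measure `dA = (1/π) dx dy` on the unit disc. -/
def diskArea : Measure ℂ := (ENNReal.ofReal Real.pi)⁻¹ • volume.restrict unitDisk

/-- The (possibly infinite) norm of the weighted Bergman space `A^p_α`,
`((α + 1) ∫_𝔻 (1 - |z|)^α |f(z)|^p dA(z))^(1/p)`. -/
def bergmanNorm (p α : ℝ) (f : ℂ → ℂ) : ENNReal :=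
  (ENNReal.ofReal (α + 1) *
    ∫⁻ z, ENNReal.ofReal ((1 - ‖z‖) ^ α * ‖f z‖ ^ p) ∂diskArea) ^ (1 / p)

/-- The weighted Bergman space `A^p_α`. -/
def Bergman (p α : ℝ) : Set (ℂ → ℂ) := {f | f ∈ HolDisk ∧ bergmanNorm p α f < ⊤}

/-- The analytic Besov space `B^p`, for `1 < p < ∞`: analytic `f` with `f' ∈ A^p_{p-2}`. -/
def Besov (p : ℝ) : Set (ℂ → ℂ) := {f | f ∈ HolDisk ∧ deriv f ∈ Bergman p (p - 2)}

/-- The Bloch space `𝓑`. -/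
def Bloch : Set (ℂ → ℂ) :=
  {f | f ∈ HolDisk ∧ BddAbove ((fun z : ℂ => (1 - ‖z‖ ^ 2) * ‖deriv f z‖) '' unitDisk)}

/-- The space `H^∞` of bounded analytic functions in the disc. -/
def HInfinity : Set (ℂ → ℂ) :=
  {f | f ∈ HolDisk ∧ BddAbove ((fun z : ℂ => ‖f z‖) '' unitDisk)}

/-- The `α`-logarithmic Bloch space `𝓑_{log,α}`, for `α > 0`. -/
def LogBloch (α : ℝ) : Set (ℂ → ℂ) :=
  {f | f ∈ HolDisk ∧
    BddAbove ((fun z : ℂ =>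
      (1 - ‖z‖ ^ 2) * Real.log (2 / (1 - ‖z‖ ^ 2)) ^ α * ‖deriv f z‖) '' unitDisk)}

/-- The complex line integral `∫_0^z h(ξ) dξ` along the segment `ξ = t z`, `0 ≤ t ≤ 1`
(for `h` analytic in the disc it does not depend on the path in the disc). -/
def segmentIntegral (h : ℂ → ℂ) (z : ℂ) : ℂ := ∫ t in (0 : ℝ)..1, h ((t : ℂ) * z) * z

/-- The Volterra operator `T_g(f)(z) = ∫_0^z g'(ξ) f(ξ) dξ`. -/
def volterraT (g f : ℂ → ℂ) : ℂ → ℂ := segmentIntegral fun ξ => deriv g ξ * f ξ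

/-- The companion operator `I_g(f)(z) = ∫_0^z g(ξ) f'(ξ) dξ`. -/
def companionI (g f : ℂ → ℂ) : ℂ → ℂ := segmentIntegral fun ξ => g ξ * deriv f ξ

/-- The multiplication operator `M_g(f)(z) = g(z) f(z)`. -/
def multM (g f : ℂ → ℂ) : ℂ → ℂ := fun z => g z * f z

end

/-! The derivatives of `I_g f`, `T_g f` and `M_g f` are `g f'`, `g' f` and their sum, so each
membership in the Bloch space is a bound on `(1 - |z|²)` times one of these expressions.

Sufficiency rests on two growth estimates for `f` in `B^p`: `(1 - |z|)|f'(z)|` is bounded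
(`one_sub_norm_mul_norm_le`), and `f` grows at most like `log(2/(1 - |z|²))^(1/p')`
(`norm_le_log_rpow_of_besov`). Both come from the sub-mean value property of `|f'|^p`; the second
adds Hölder's inequality along a radius.

Necessity evaluates at `z = a` two families whose Besov energies are bounded uniformly in `a`. The
disc automorphism `φ_a` vanishes at `a` and has `(1 - |a|²)|φ_a'(a)| = 1`, so it isolates `|g(a)|`,
even for `M_g`. The normalized logarithm `logTest` attains the maximal growth at `a` and detects the
logarithmic Bloch condition. For `M_g`, once `g` is bounded, the `g f'` term can be subtracted,
which leaves the case of `T_g`.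

The hypothesis only gives a bound for each `f`; `exists_uniform_bound_of_besov` makes it uniform.
Banach–Steinhaus is applied on `ℓ¹`, through the series `∑ c_n F_n`, so no Banach space structure on
`B^p` is needed. -/

/-- The integral `∫_𝔻 (1 - |z|)^(p-2) |h(z)|^p dx dy`. -/
noncomputable def besovEnergy (p : ℝ) (h : ℂ → ℂ) : ENNReal :=
  ∫⁻ z in unitDisk, ENNReal.ofReal ((1 - ‖z‖) ^ (p - 2) * ‖h z‖ ^ p)

lemma isOpen_unitDisk : IsOpen unitDisk := Metric.isOpen_ball

lemma mem_unitDisk {z : ℂ} : z ∈ unitDisk ↔ ‖z‖ < 1 := by simp [unitDisk]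

lemma HolDisk.deriv_mem {f : ℂ → ℂ} (hf : f ∈ HolDisk) : deriv f ∈ HolDisk :=
  DifferentiableOn.deriv hf isOpen_unitDisk

lemma mem_besov_iff {p : ℝ} (hp : 1 < p) {f : ℂ → ℂ} :
    f ∈ Besov p ↔ f ∈ HolDisk ∧ besovEnergy p (deriv f) < ⊤ := by
  have key : bergmanNorm p (p - 2) (deriv f) < ⊤ ↔ besovEnergy p (deriv f) < ⊤ := by
    unfold bergmanNorm besovEnergy diskArea
    rw [ENNReal.rpow_lt_top_iff_of_pos (by positivity), lintegral_smul_measure, smul_eq_mul]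
    constructor
    · intro h
      by_contra hne
      rw [not_lt, top_le_iff] at hne
      rw [hne, ENNReal.mul_top, ENNReal.mul_top] at h
      · exact absurd h (lt_irrefl _)
      · simp; linarith
      · simp
    · intro h
      refine ENNReal.mul_lt_top ENNReal.ofReal_lt_top (ENNReal.mul_lt_top ?_ h)
      simp [Real.pi_pos]
  constructor
  · rintro ⟨h1, h2⟩
    exact ⟨h1, key.1 h2.2⟩
  · rintro ⟨h1, h2⟩
    exact ⟨h1, HolDisk.deriv_mem h1, key.2 h2⟩

/-! ### Integration tools and primitives on the disc -/

lemma lintegral_ball_eq_polar {f : ℂ → ENNReal} {R : ℝ}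
    (hf : ContinuousOn f (Metric.ball 0 R)) :
    ∫⁻ z in Metric.ball (0 : ℂ) R, f z = ∫⁻ r in Ioo 0 R, ENNReal.ofReal r *
      ∫⁻ θ in Ioo (-Real.pi) Real.pi, f (r * Complex.exp (θ * Complex.I)) := by
  classical
  have hm : Measurable ((Metric.ball (0 : ℂ) R).indicator f) := by
    have := hf.measurable_piecewise (g := fun _ => 0) continuousOn_const
      (measurableSet_ball (x := (0 : ℂ)) (ε := R))
    simpa [Set.piecewise_eq_indicator] using! this
  rw [← lintegral_indicator measurableSet_ball, ← Complex.lintegral_comp_polarCoord_symm]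
  have hsymm : ∀ q : ℝ × ℝ, Complex.polarCoord.symm q = q.1 * Complex.exp (q.2 * Complex.I) := by
    intro q
    rw [Complex.polarCoord_symm_apply, Complex.exp_mul_I, Complex.ofReal_cos, Complex.ofReal_sin]
  have hc : Measurable fun q : ℝ × ℝ => (q.1 : ℂ) * Complex.exp (q.2 * Complex.I) := by fun_prop
  simp only [hsymm, smul_eq_mul]
  rw [polarCoord_target, Measure.volume_eq_prod, ← Measure.prod_restrict, lintegral_prod]
  · rw [← lintegral_indicator measurableSet_Ioi, ← lintegral_indicator measurableSet_Ioo]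
    refine lintegral_congr fun r => ?_
    by_cases h0 : 0 < r
    · rw [indicator_of_mem (by exact h0)]
      dsimp only
      rw [lintegral_const_mul' _ _ ENNReal.ofReal_ne_top]
      by_cases hR : r < R
      · rw [indicator_of_mem (by exact ⟨h0, hR⟩)]
        congr 1
        refine lintegral_congr fun θ => ?_
        rw [indicator_of_mem]
        simp [Complex.norm_exp, abs_of_pos h0, hR]
      · rw [indicator_of_notMem (by simp [hR])]
        convert mul_zero _
        convert lintegral_zero with θ
        rw [indicator_of_notMem]
        simp [Complex.norm_exp, abs_of_pos h0, not_lt.1 hR]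
    · rw [indicator_of_notMem (by simpa using h0), indicator_of_notMem (by simp [h0])]
  · exact ((ENNReal.measurable_ofReal.comp measurable_fst).mul (hm.comp hc)).aemeasurable

/-- A nonnegative derivative is automatically integrable. Since only continuity is asked of `G` at
the endpoints, weights singular there are covered. -/
lemma lintegral_Ioo_ofReal_of_hasDerivAt {a b : ℝ} (hab : a ≤ b) {G G' : ℝ → ℝ}
    (hc : ContinuousOn G (Icc a b)) (hd : ∀ x ∈ Ioo a b, HasDerivAt G (G' x) x)
    (hpos : ∀ x ∈ Ioo a b, 0 ≤ G' x) :
    ∫⁻ x in Ioo a b, ENNReal.ofReal (G' x) = ENNReal.ofReal (G b - G a) := by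
  have hint : IntegrableOn G' (Ioc a b) :=
    intervalIntegral.integrableOn_deriv_of_nonneg hc hd hpos
  rw [← intervalIntegral.integral_eq_sub_of_hasDerivAt_of_le hab hc hd
    ((intervalIntegrable_iff_integrableOn_Ioc_of_le hab).2 hint),
    intervalIntegral.integral_of_le hab, integral_Ioc_eq_integral_Ioo,
    ofReal_integral_eq_lintegral_ofReal (hint.mono_set Ioo_subset_Ioc_self)]
  exact (ae_restrict_iff' measurableSet_Ioo).2 (Filter.Eventually.of_forall hpos)

lemma hasDerivAt_segmentIntegral {h : ℂ → ℂ} (hh : h ∈ HolDisk) {z : ℂ} (hz : z ∈ unitDisk) :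
    HasDerivAt (segmentIntegral h) (h z) z := by
  obtain ⟨F, hF⟩ := DifferentiableOn.isExactOn_ball (c := (0 : ℂ)) (r := 1) hh
  have key : ∀ w ∈ unitDisk, segmentIntegral h w = F w - F 0 := by
    intro w hw
    have hmem : ∀ t ∈ uIcc (0 : ℝ) 1, (t : ℂ) * w ∈ unitDisk := by
      intro t ht
      rw [uIcc_of_le zero_le_one] at ht
      rw [mem_unitDisk] at hw ⊢
      rw [norm_mul, Complex.norm_real, Real.norm_of_nonneg ht.1]
      nlinarith [norm_nonneg w, ht.2]
    have hd : ∀ t ∈ uIcc (0 : ℝ) 1,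
        HasDerivAt (fun s : ℝ => F ((s : ℂ) * w)) (h ((t : ℂ) * w) * w) t := by
      intro t ht
      have h1 : HasDerivAt (fun s : ℝ => (s : ℂ) * w) w t := by
        simpa using (Complex.ofRealCLM.hasDerivAt (x := t)).mul_const w
      exact (hF _ (hmem t ht)).comp t h1
    have hcont : ContinuousOn (fun t : ℝ => h ((t : ℂ) * w) * w) (uIcc 0 1) :=
      (ContinuousOn.comp hh.continuousOn (by fun_prop) hmem).mul continuousOn_const
    have := intervalIntegral.integral_eq_sub_of_hasDerivAt hd hcont.intervalIntegrable
    simpa [segmentIntegral] using this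
  refine ((hF z hz).sub_const (F 0)).congr_of_eventuallyEq ?_
  filter_upwards [isOpen_unitDisk.mem_nhds hz] with w hw using key w hw

lemma segmentIntegral_mem_holDisk {h : ℂ → ℂ} (hh : h ∈ HolDisk) : segmentIntegral h ∈ HolDisk :=
  fun _ hz => (hasDerivAt_segmentIntegral hh hz).differentiableAt.differentiableWithinAt

/-! ### Sub-mean value estimates and growth of the derivative -/

/-- The mean value property over the circle, followed by Jensen's inequality for `t ↦ t^p`. -/
lemma norm_rpow_le_lintegral_circle {h : ℂ → ℂ} {z : ℂ} {r R p : ℝ} (hp : 1 ≤ p) (hr : 0 < r)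
    (hrR : r < R) (hh : DifferentiableOn ℂ h (Metric.ball z R)) :
    ENNReal.ofReal (2 * Real.pi * ‖h z‖ ^ p) ≤ ∫⁻ θ in Ioo (-Real.pi) Real.pi,
      ENNReal.ofReal (‖h (z + r * Complex.exp (θ * Complex.I))‖ ^ p) := by
  set φ : ℝ → ℂ := fun θ => h (z + r * Complex.exp (θ * Complex.I))
  have hπ := Real.pi_pos
  have hcont : Continuous φ := by
    refine hh.continuousOn.comp_continuous (by fun_prop) fun θ => ?_
    simp [Complex.norm_exp, abs_of_pos hr, hrR]
  have hcl : DiffContOnCl ℂ h (Metric.ball z |r|) := by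
    rw [abs_of_pos hr]
    refine DifferentiableOn.diffContOnCl (hh.mono ?_)
    rw [closure_ball _ hr.ne']
    exact Metric.closedBall_subset_ball hrR
  have hmean : h z = (2 * Real.pi)⁻¹ • ∫ θ in Ioo (-Real.pi) Real.pi, φ θ := by
    rw [← hcl.circleAverage, Real.circleAverage_eq_integral_add (-Real.pi),
      intervalIntegral.integral_comp_add_right (fun θ => h (circleMap z r θ)),
      intervalIntegral.integral_of_le (by linarith), integral_Ioc_eq_integral_Ioo]
    rw [zero_add, show 2 * Real.pi + -Real.pi = Real.pi by ring]
    rfl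
  have hint : ∀ {E : Type} [NormedAddCommGroup E] {ψ : ℝ → E}, Continuous ψ →
      Integrable ψ (volume.restrict (Ioo (-Real.pi) Real.pi)) := fun {E} _ ψ hψ =>
    ((hψ.continuousOn.integrableOn_compact isCompact_Icc).mono_set Ioo_subset_Icc_self)
  have hvol : (volume.restrict (Ioo (-Real.pi) Real.pi)).real univ = 2 * Real.pi := by
    rw [measureReal_restrict_apply_univ, Real.volume_real_Ioo_of_le (by linarith)]
    ring
  have : NeZero (volume.restrict (Ioo (-Real.pi) Real.pi)) := ⟨by
    intro h0
    rw [h0] at hvol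
    simp at hvol⟩
  have hJ := (convexOn_rpow hp).map_average_le (μ := volume.restrict (Ioo (-Real.pi) Real.pi))
    (f := fun θ => ‖φ θ‖) (Real.continuous_rpow_const (by linarith)).continuousOn isClosed_Ici
    (Filter.Eventually.of_forall fun θ => norm_nonneg _) (hint hcont.norm)
    (hint ((Real.continuous_rpow_const (by linarith)).comp hcont.norm))
  rw [average_eq, average_eq, hvol, smul_eq_mul, smul_eq_mul] at hJ
  have hle : ‖h z‖ ≤ (2 * Real.pi)⁻¹ * ∫ θ in Ioo (-Real.pi) Real.pi, ‖φ θ‖ := by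
    rw [hmean, norm_smul, Real.norm_of_nonneg (by positivity)]
    gcongr
    exact norm_integral_le_integral_norm _
  have h2 : 2 * Real.pi * ‖h z‖ ^ p ≤ ∫ θ in Ioo (-Real.pi) Real.pi, ‖φ θ‖ ^ p := by
    have := (Real.rpow_le_rpow (norm_nonneg _) hle (by linarith)).trans hJ
    rw [inv_mul_eq_div, le_div_iff₀ (by positivity)] at this
    linarith
  refine (ENNReal.ofReal_le_ofReal h2).trans_eq ?_
  exact ofReal_integral_eq_lintegral_ofReal
    (hint ((Real.continuous_rpow_const (by linarith)).comp hcont.norm))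
    (Filter.Eventually.of_forall fun θ => by positivity)

lemma norm_rpow_mul_area_le_lintegral_ball {h : ℂ → ℂ} {z : ℂ} {R p : ℝ} (hp : 1 ≤ p)
    (hR : 0 < R) (hh : DifferentiableOn ℂ h (Metric.ball z R)) :
    ENNReal.ofReal (Real.pi * R ^ 2 * ‖h z‖ ^ p) ≤
      ∫⁻ w in Metric.ball z R, ENNReal.ofReal (‖h w‖ ^ p) := by
  have htrans : ∫⁻ w in Metric.ball z R, ENNReal.ofReal (‖h w‖ ^ p) =
      ∫⁻ w in Metric.ball (0 : ℂ) R, ENNReal.ofReal (‖h (z + w)‖ ^ p) := by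
    rw [← (measurePreserving_add_left volume z).setLIntegral_comp_preimage_emb
      (measurableEmbedding_addLeft z)]
    congr 2
    ext w
    simp
  have hπ := Real.pi_pos
  have hcont : ContinuousOn (fun w => ENNReal.ofReal (‖h (z + w)‖ ^ p)) (Metric.ball 0 R) := by
    refine ENNReal.continuous_ofReal.comp_continuousOn ?_
    refine (Real.continuous_rpow_const (by linarith)).comp_continuousOn ?_
    refine ContinuousOn.norm (hh.continuousOn.comp (by fun_prop) fun w hw => ?_)
    simpa using hw
  rw [htrans, lintegral_ball_eq_polar hcont]
  calc ENNReal.ofReal (Real.pi * R ^ 2 * ‖h z‖ ^ p)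
      = ENNReal.ofReal (R ^ 2 / 2 - 0 ^ 2 / 2) * ENNReal.ofReal (2 * Real.pi * ‖h z‖ ^ p) := by
        rw [← ENNReal.ofReal_mul (by simp; positivity)]
        congr 1
        ring
    _ = (∫⁻ r in Ioo 0 R, ENNReal.ofReal r) * ENNReal.ofReal (2 * Real.pi * ‖h z‖ ^ p) := by
        rw [lintegral_Ioo_ofReal_of_hasDerivAt (G := fun r => r ^ 2 / 2) (G' := fun r => r) hR.le
          (by fun_prop) (fun x _ => ?_) (fun x hx => hx.1.le)]
        convert! (hasDerivAt_pow 2 x).div_const 2 using 1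
        simp
    _ = ∫⁻ r in Ioo 0 R, ENNReal.ofReal r * ENNReal.ofReal (2 * Real.pi * ‖h z‖ ^ p) := by
        rw [lintegral_mul_const _ ENNReal.measurable_ofReal]
    _ ≤ _ := by
        refine setLIntegral_mono' measurableSet_Ioo fun r hr => ?_
        gcongr
        exact norm_rpow_le_lintegral_circle hp hr.1 hr.2 hh

lemma rpow_le_two_rpow_abs_mul {x y : ℝ} (hx : 0 < x) (hy : 0 < y) (hxy : x ≤ 2 * y)
    (hyx : y ≤ 2 * x) (s : ℝ) : x ^ s ≤ 2 ^ |s| * y ^ s := by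
  rcases le_total 0 s with hs | hs
  · rw [abs_of_nonneg hs, ← Real.mul_rpow (by norm_num) hy.le]
    exact Real.rpow_le_rpow hx.le hxy hs
  · rw [abs_of_nonpos hs, Real.rpow_neg (by norm_num), ← Real.inv_rpow (by norm_num),
      ← Real.mul_rpow (by norm_num) hy.le]
    exact Real.rpow_le_rpow_of_nonpos (by positivity) (by linarith) hs

lemma ball_subset_unitDisk {z : ℂ} (hz : z ∈ unitDisk) :
    Metric.ball z ((1 - ‖z‖) / 2) ⊆ unitDisk := by
  intro w hw
  rw [mem_unitDisk] at hz ⊢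
  rw [Metric.mem_ball, dist_eq_norm] at hw
  have := norm_sub_norm_le w z
  linarith

lemma one_sub_norm_comparable {z w : ℂ} (hw : w ∈ Metric.ball z ((1 - ‖z‖) / 2)) :
    1 - ‖z‖ ≤ 2 * (1 - ‖w‖) ∧ 1 - ‖w‖ ≤ 2 * (1 - ‖z‖) := by
  rw [Metric.mem_ball, dist_eq_norm] at hw
  have h1 := abs_le.1 (abs_norm_sub_norm_le w z)
  constructor <;> linarith [norm_nonneg (w - z)]

/-- On the disc of radius `(1 - |z|)/2` about `z` the weight `1 - |w|` stays within a factor 2 of `1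
- |z|`, so it can be moved inside the area mean. The area `π(1 - |z|)²/4` accounts for the exponent
`s + 2` and the constant `4/π`. -/
lemma one_sub_norm_rpow_mul_norm_rpow_le {h : ℂ → ℂ} (hh : h ∈ HolDisk) {p : ℝ} (hp : 1 ≤ p)
    (s : ℝ) {z : ℂ} (hz : z ∈ unitDisk) :
    ENNReal.ofReal ((1 - ‖z‖) ^ (s + 2) * ‖h z‖ ^ p) ≤
      ∫⁻ w in Metric.ball z ((1 - ‖z‖) / 2),
        ENNReal.ofReal (4 / Real.pi * 2 ^ |s| * ((1 - ‖w‖) ^ s * ‖h w‖ ^ p)) := by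
  have hπ := Real.pi_pos
  have hδ : 0 < 1 - ‖z‖ := by rw [mem_unitDisk] at hz; linarith
  have hsub := ball_subset_unitDisk hz
  calc ENNReal.ofReal ((1 - ‖z‖) ^ (s + 2) * ‖h z‖ ^ p)
      = ENNReal.ofReal (4 / Real.pi * (1 - ‖z‖) ^ s) *
          ENNReal.ofReal (Real.pi * ((1 - ‖z‖) / 2) ^ 2 * ‖h z‖ ^ p) := by
        rw [← ENNReal.ofReal_mul (by positivity), Real.rpow_add hδ, Real.rpow_two]
        congr 1
        field_simp
        ring
    _ ≤ ENNReal.ofReal (4 / Real.pi * (1 - ‖z‖) ^ s) *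
          ∫⁻ w in Metric.ball z ((1 - ‖z‖) / 2), ENNReal.ofReal (‖h w‖ ^ p) := by
        gcongr
        exact norm_rpow_mul_area_le_lintegral_ball hp (by linarith) (hh.mono hsub)
    _ = ∫⁻ w in Metric.ball z ((1 - ‖z‖) / 2),
          ENNReal.ofReal (4 / Real.pi * (1 - ‖z‖) ^ s) * ENNReal.ofReal (‖h w‖ ^ p) := by
        rw [lintegral_const_mul' _ _ ENNReal.ofReal_ne_top]
    _ ≤ _ := by
        refine setLIntegral_mono' measurableSet_ball fun w hw => ?_
        rw [← ENNReal.ofReal_mul (by positivity)]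
        refine ENNReal.ofReal_le_ofReal ?_
        obtain ⟨h1, h2⟩ := one_sub_norm_comparable hw
        have := rpow_le_two_rpow_abs_mul hδ (by linarith) h1 h2 s
        calc 4 / Real.pi * (1 - ‖z‖) ^ s * ‖h w‖ ^ p
            ≤ 4 / Real.pi * (2 ^ |s| * (1 - ‖w‖) ^ s) * ‖h w‖ ^ p := by gcongr
          _ = _ := by ring

lemma continuousOn_one_sub_norm_rpow_mul {h : ℂ → ℂ} (hh : h ∈ HolDisk) {p : ℝ} (hp : 0 ≤ p)
    (s : ℝ) : ContinuousOn (fun w => (1 - ‖w‖) ^ s * ‖h w‖ ^ p) unitDisk := by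
  refine ContinuousOn.mul ?_ ?_
  · refine ContinuousOn.rpow_const (by fun_prop) fun w hw => Or.inl ?_
    rw [mem_unitDisk] at hw
    linarith
  · exact (hh.continuousOn.norm).rpow_const fun w _ => Or.inr hp

/-- The constant depends only on `p` and the energy bound `K`, so the estimate also serves whole
families. -/
lemma one_sub_norm_mul_norm_le {p : ℝ} (hp : 1 < p) {K : ENNReal} (hKt : K < ⊤) :
    ∃ C, ∀ h ∈ HolDisk, besovEnergy p h ≤ K → ∀ z ∈ unitDisk, (1 - ‖z‖) * ‖h z‖ ≤ C := by
  set k := 4 / Real.pi * 2 ^ |p - 2|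
  have hk : 0 ≤ k := by have := Real.pi_pos; positivity
  have hfin : ENNReal.ofReal k * K ≠ ⊤ :=
    (ENNReal.mul_lt_top ENNReal.ofReal_lt_top hKt).ne
  refine ⟨(ENNReal.ofReal k * K).toReal ^ p⁻¹, fun h hh hE z hz => ?_⟩
  have hδ : 0 < 1 - ‖z‖ := by rw [mem_unitDisk] at hz; linarith
  have h1 := one_sub_norm_rpow_mul_norm_rpow_le hh hp.le (p - 2) hz
  have h2 : ∫⁻ w in Metric.ball z ((1 - ‖z‖) / 2),
      ENNReal.ofReal (k * ((1 - ‖w‖) ^ (p - 2) * ‖h w‖ ^ p)) ≤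
      ENNReal.ofReal k * K := by
    simp only [ENNReal.ofReal_mul hk]
    rw [lintegral_const_mul' _ _ ENNReal.ofReal_ne_top]
    gcongr
    exact (lintegral_mono_set (ball_subset_unitDisk hz)).trans hE
  have h3 := (ENNReal.ofReal_le_iff_le_toReal hfin).1 (h1.trans h2)
  rw [sub_add_cancel, ← Real.mul_rpow hδ.le (norm_nonneg _)] at h3
  exact (Real.le_rpow_inv_iff_of_pos (by positivity) (by positivity) (by linarith)).2 h3

/-! ### Radial integrals and logarithmic growth of Besov functions -/

/-- The sub-mean value estimate with weight exponent `p - 3` is integrated over the radius and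
Tonelli is applied. A given `w` lies only in discs whose centre `r e` has `r` in an interval of
length `2(1 - |w|)`; this length raises `p - 3` to `p - 2` and turns the constant 4 into 8. -/
lemma lintegral_radial_le {h : ℂ → ℂ} (hh : h ∈ HolDisk) {p : ℝ} (hp : 1 < p) {e : ℂ}
    (he : ‖e‖ = 1) :
    ∫⁻ r in Ioo (0 : ℝ) 1, ENNReal.ofReal ((1 - r) ^ (p - 1) * ‖h (r * e)‖ ^ p) ≤
      ENNReal.ofReal (8 / Real.pi * 2 ^ |p - 3|) * besovEnergy p h := by
  have hπ := Real.pi_pos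
  set k : ℂ → ENNReal := fun w =>
    ENNReal.ofReal (4 / Real.pi * 2 ^ |p - 3| * ((1 - ‖w‖) ^ (p - 3) * ‖h w‖ ^ p)) with hk
  set S : Set (ℝ × ℂ) := {q | ‖q.2 - q.1 * e‖ < (1 - q.1) / 2} with hS
  have hSo : IsOpen S := isOpen_lt (by fun_prop) (by fun_prop)
  have hkm : AEMeasurable k (volume.restrict unitDisk) :=
    (ENNReal.continuous_ofReal.comp_continuousOn (continuousOn_const.mul
      (continuousOn_one_sub_norm_rpow_mul hh (by linarith) _))).aemeasurable
      isOpen_unitDisk.measurableSet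
  have hnorm : ∀ r ∈ Ioo (0 : ℝ) 1, ‖(r : ℂ) * e‖ = r := by
    intro r hr
    rw [norm_mul, he, Complex.norm_real, Real.norm_of_nonneg hr.1.le, mul_one]
  calc ∫⁻ r in Ioo (0 : ℝ) 1, ENNReal.ofReal ((1 - r) ^ (p - 1) * ‖h (r * e)‖ ^ p)
      ≤ ∫⁻ r in Ioo (0 : ℝ) 1, ∫⁻ w in unitDisk, S.indicator (fun q => k q.2) (r, w) := by
        refine setLIntegral_mono' measurableSet_Ioo fun r hr => ?_
        have hz : (r : ℂ) * e ∈ unitDisk := by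
          rw [mem_unitDisk, hnorm r hr]; exact hr.2
        have h1 := one_sub_norm_rpow_mul_norm_rpow_le hh hp.le (p - 3) hz
        have h2 := ball_subset_unitDisk hz
        rw [hnorm r hr] at h1 h2
        rw [show p - 3 + 2 = p - 1 by ring] at h1
        refine h1.trans ?_
        rw [← lintegral_indicator measurableSet_ball,
          ← lintegral_indicator isOpen_unitDisk.measurableSet]
        refine lintegral_mono fun w => ?_
        by_cases hw : w ∈ Metric.ball ((r : ℂ) * e) ((1 - r) / 2)
        · rw [indicator_of_mem hw, indicator_of_mem (h2 hw), indicator_of_mem]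
          rw [Metric.mem_ball, dist_eq_norm] at hw
          exact hw
        · rw [indicator_of_notMem hw]
          exact zero_le
    _ = ∫⁻ w in unitDisk, ∫⁻ r in Ioo (0 : ℝ) 1, S.indicator (fun q => k q.2) (r, w) := by
        refine lintegral_lintegral_swap ?_
        exact (hkm.comp_snd).indicator hSo.measurableSet
    _ ≤ ∫⁻ w in unitDisk, ENNReal.ofReal (8 / Real.pi * 2 ^ |p - 3|) *
          ENNReal.ofReal ((1 - ‖w‖) ^ (p - 2) * ‖h w‖ ^ p) := by
        refine setLIntegral_mono' isOpen_unitDisk.measurableSet fun w hw => ?_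
        have hd : 0 < 1 - ‖w‖ := by rw [mem_unitDisk] at hw; linarith
        calc ∫⁻ r in Ioo (0 : ℝ) 1, S.indicator (fun q => k q.2) (r, w)
            ≤ ∫⁻ r in Ioo (0 : ℝ) 1, (Ioo (1 - 2 * (1 - ‖w‖)) 1).indicator (fun _ => k w) r := by
              refine setLIntegral_mono' measurableSet_Ioo fun r hr => ?_
              by_cases hrw : (r, w) ∈ S
              · rw [indicator_of_mem hrw, indicator_of_mem]
                have hb : w ∈ Metric.ball ((r : ℂ) * e) ((1 - ‖(r : ℂ) * e‖) / 2) := by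
                  rw [Metric.mem_ball, dist_eq_norm, hnorm r hr]
                  exact hrw
                have := (one_sub_norm_comparable hb).1
                rw [hnorm r hr] at this
                have h2 : ‖w - r * e‖ < (1 - r) / 2 := hrw
                have h3 := norm_sub_norm_le w (r * e)
                rw [hnorm r hr] at h3
                have := hr.2
                constructor <;> linarith
              · rw [indicator_of_notMem hrw]
                exact zero_le
          _ ≤ ∫⁻ r, (Ioo (1 - 2 * (1 - ‖w‖)) 1).indicator (fun _ => k w) r :=
              setLIntegral_le_lintegral _ _
          _ = k w * ENNReal.ofReal (2 * (1 - ‖w‖)) := by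
              rw [lintegral_indicator measurableSet_Ioo, setLIntegral_const, Real.volume_Ioo]
              congr 2
              ring
          _ = _ := by
              rw [← ENNReal.ofReal_mul (by positivity), ← ENNReal.ofReal_mul (by positivity),
                show p - 2 = (p - 3) + 1 by ring, Real.rpow_add hd, Real.rpow_one]
              congr 1
              ring
    _ = _ := by
        rw [lintegral_const_mul' _ _ ENNReal.ofReal_ne_top]
        rfl

lemma lintegral_Ioo_one_sub_inv {ρ : ℝ} (h0 : 0 ≤ ρ) (h1 : ρ < 1) :
    ∫⁻ r in Ioo 0 ρ, ENNReal.ofReal ((1 - r)⁻¹) = ENNReal.ofReal (Real.log (1 / (1 - ρ))) := by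
  rw [lintegral_Ioo_ofReal_of_hasDerivAt (G := fun r => -Real.log (1 - r)) h0]
  · simp
  · refine ContinuousOn.neg (ContinuousOn.log (by fun_prop) fun x hx => ?_)
    linarith [hx.2]
  · intro x hx
    have hx1 : 1 - x ≠ 0 := by linarith [hx.2]
    have := ((hasDerivAt_id x).const_sub 1).log hx1
    convert! this.neg using 1
    simp [neg_div]
  · intro x hx
    have : 0 < 1 - x := by linarith [hx.2]
    positivity

lemma ofReal_norm_sub_le_lintegral {f : ℂ → ℂ} (hf : f ∈ HolDisk) {e : ℂ} (he : ‖e‖ = 1) {ρ : ℝ}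
    (h0 : 0 ≤ ρ) (h1 : ρ < 1) :
    ENNReal.ofReal ‖f (ρ * e) - f 0‖ ≤
      ∫⁻ r in Ioo 0 ρ, ENNReal.ofReal ‖deriv f (r * e)‖ := by
  have hmem : ∀ t ∈ uIcc (0 : ℝ) ρ, (t : ℂ) * e ∈ unitDisk := by
    intro t ht
    rw [uIcc_of_le h0] at ht
    rw [mem_unitDisk, norm_mul, he, Complex.norm_real, Real.norm_of_nonneg ht.1]
    linarith [ht.2]
  have hd : ∀ t ∈ uIcc (0 : ℝ) ρ,
      HasDerivAt (fun s : ℝ => f ((s : ℂ) * e)) (deriv f ((t : ℂ) * e) * e) t := by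
    intro t ht
    have h1 : HasDerivAt (fun s : ℝ => (s : ℂ) * e) e t := by
      simpa using (Complex.ofRealCLM.hasDerivAt (x := t)).mul_const e
    exact ((hf.differentiableAt (isOpen_unitDisk.mem_nhds (hmem t ht))).hasDerivAt).comp t h1
  have hcont : ContinuousOn (fun t : ℝ => deriv f ((t : ℂ) * e) * e) (uIcc 0 ρ) :=
    (ContinuousOn.comp (HolDisk.deriv_mem hf).continuousOn (by fun_prop) hmem).mul
      continuousOn_const
  have key := intervalIntegral.integral_eq_sub_of_hasDerivAt hd hcont.intervalIntegrable
  simp only [Complex.ofReal_zero, zero_mul] at key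
  rw [← key, intervalIntegral.integral_of_le h0, integral_Ioc_eq_integral_Ioo,
    ofReal_norm]
  refine (enorm_integral_le_lintegral_enorm _).trans_eq (lintegral_congr fun r => ?_)
  rw [enorm_mul, ← ofReal_norm e, he, ofReal_norm]
  simp

/-- Hölder's inequality for `|f'| = |f'|(1 - r)^(1/q) · (1 - r)^(-1/q)` on the radius to `z`. As
`p/q = p - 1`, the first factor is the radial integral bounded by the energy; the second yields `∫
dr/(1 - r)`, a logarithm. -/
lemma ofReal_norm_sub_le_besovEnergy {f : ℂ → ℂ} (hf : f ∈ HolDisk) {p q : ℝ}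
    (hpq : p.HolderConjugate q) {z : ℂ} (hz : z ∈ unitDisk) :
    ENNReal.ofReal ‖f z - f 0‖ ≤
      (ENNReal.ofReal (8 / Real.pi * 2 ^ |p - 3|) * besovEnergy p (deriv f)) ^ (1 / p) *
        ENNReal.ofReal (Real.log (1 / (1 - ‖z‖))) ^ (1 / q) := by
  rw [mem_unitDisk] at hz
  obtain ⟨e, he, hze⟩ : ∃ e : ℂ, ‖e‖ = 1 ∧ z = (‖z‖ : ℝ) * e := by
    refine ⟨Complex.exp (z.arg * Complex.I), by simp [Complex.norm_exp], ?_⟩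
    exact (Complex.norm_mul_exp_arg_mul_I z).symm
  set ρ := ‖z‖ with hρ
  have hp := hpq.pos
  have hq := hpq.symm.pos
  have hmem : ∀ r ∈ Ioo 0 ρ, (r : ℂ) * e ∈ unitDisk := by
    intro r hr
    rw [mem_unitDisk, norm_mul, he, Complex.norm_real, Real.norm_of_nonneg hr.1.le]
    linarith [hr.2]
  have hc1 : ContinuousOn (fun r : ℝ => ‖deriv f (r * e)‖ * (1 - r) ^ (1 / q)) (Ioo 0 ρ) :=
    (ContinuousOn.comp (HolDisk.deriv_mem hf).continuousOn (by fun_prop) hmem).norm.mul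
      (ContinuousOn.rpow_const (by fun_prop) fun r _ => Or.inr (by positivity))
  have hc2 : ContinuousOn (fun r : ℝ => (1 - r) ^ (-(1 / q))) (Ioo 0 ρ) :=
    ContinuousOn.rpow_const (by fun_prop) fun r hr => Or.inl (by linarith [hr.2])
  have hpos : ∀ r ∈ Ioo 0 ρ, 0 < 1 - r := fun r hr => by linarith [hr.2]
  calc ENNReal.ofReal ‖f z - f 0‖
      ≤ ∫⁻ r in Ioo 0 ρ, ENNReal.ofReal ‖deriv f (r * e)‖ := by
        rw [hze]
        exact ofReal_norm_sub_le_lintegral hf he (norm_nonneg z) hz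
    _ = ∫⁻ r in Ioo 0 ρ, ((fun r : ℝ => ENNReal.ofReal (‖deriv f (r * e)‖ * (1 - r) ^ (1 / q))) *
          (fun r : ℝ => ENNReal.ofReal ((1 - r) ^ (-(1 / q))))) r := by
        refine setLIntegral_congr_fun measurableSet_Ioo fun r hr => ?_
        have := hpos r hr
        rw [Pi.mul_apply, ← ENNReal.ofReal_mul (by positivity), mul_assoc, ← Real.rpow_add this,
          add_neg_cancel, Real.rpow_zero, mul_one]
    _ ≤ _ := by
        refine (ENNReal.lintegral_mul_le_Lp_mul_Lq _ hpq
          (ENNReal.continuous_ofReal.comp_continuousOn hc1 |>.aemeasurable measurableSet_Ioo)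
          (ENNReal.continuous_ofReal.comp_continuousOn hc2 |>.aemeasurable
            measurableSet_Ioo)).trans ?_
        refine mul_le_mul' (ENNReal.rpow_le_rpow ?_ (by positivity))
          (ENNReal.rpow_le_rpow ?_ (by positivity))
        · refine le_trans ?_ (lintegral_radial_le (HolDisk.deriv_mem hf) hpq.lt he)
          refine le_trans (le_of_eq ?_) (lintegral_mono_set (Ioo_subset_Ioo_right hz.le))
          refine setLIntegral_congr_fun measurableSet_Ioo fun r hr => ?_
          have := hpos r hr
          rw [Function.comp_apply, ENNReal.ofReal_rpow_of_nonneg (by positivity) hp.le,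
            Real.mul_rpow (by positivity) (by positivity), ← Real.rpow_mul this.le, mul_comm,
            one_div_mul_eq_div, hpq.div_conj_eq_sub_one]
        · rw [← lintegral_Ioo_one_sub_inv (norm_nonneg z) hz]
          refine le_of_eq (setLIntegral_congr_fun measurableSet_Ioo fun r hr => ?_)
          have := hpos r hr
          rw [Function.comp_apply, ENNReal.ofReal_rpow_of_nonneg (by positivity) hq.le, ← Real.rpow_mul this.le,
            neg_mul, one_div_mul_cancel hq.ne', Real.rpow_neg_one]

/-- The logarithmic weight is bounded below on the disc, and dominates `log (1 / (1 - |z|))`. -/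
lemma log_weight_bounds {z : ℂ} (hz : z ∈ unitDisk) :
    Real.log 2 ≤ Real.log (2 / (1 - ‖z‖ ^ 2)) ∧
      Real.log (1 / (1 - ‖z‖)) ≤ Real.log (2 / (1 - ‖z‖ ^ 2)) := by
  rw [mem_unitDisk] at hz
  have h0 := norm_nonneg z
  have h1 : 0 < 1 - ‖z‖ := by linarith
  have h2 : 0 < 1 - ‖z‖ ^ 2 := by nlinarith
  constructor
  · refine Real.log_le_log (by norm_num) ?_
    rw [le_div_iff₀ h2]
    nlinarith
  · refine Real.log_le_log (by positivity) ?_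
    rw [div_le_div_iff₀ h1 h2]
    nlinarith

lemma norm_le_log_rpow_of_besov {f : ℂ → ℂ} {p q : ℝ} (hpq : p.HolderConjugate q)
    (hf : f ∈ Besov p) :
    ∃ C, ∀ z ∈ unitDisk, ‖f z‖ ≤ C * Real.log (2 / (1 - ‖z‖ ^ 2)) ^ (1 / q) := by
  obtain ⟨hf, hE⟩ := (mem_besov_iff hpq.lt).1 hf
  have hp := hpq.pos
  have hq := hpq.symm.pos
  set A := (ENNReal.ofReal (8 / Real.pi * 2 ^ |p - 3|) * besovEnergy p (deriv f)) ^ (1 / p) with hA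
  have hAt : A ≠ ⊤ := ENNReal.rpow_ne_top_of_nonneg (by positivity)
    (ENNReal.mul_lt_top ENNReal.ofReal_lt_top hE).ne
  have hl2 : 0 < Real.log 2 := Real.log_pos one_lt_two
  -- The weight is at least `log 2`, which lets the constant `f 0` be absorbed into it.
  refine ⟨A.toReal + ‖f 0‖ / Real.log 2 ^ (1 / q), fun z hz => ?_⟩
  obtain ⟨h1, h2⟩ := log_weight_bounds hz
  set L := Real.log (2 / (1 - ‖z‖ ^ 2))
  have hL : 0 < L := hl2.trans_le h1
  have h3 := ofReal_norm_sub_le_besovEnergy hf hpq hz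
  have h4 : ENNReal.ofReal ‖f z - f 0‖ ≤ ENNReal.ofReal (A.toReal * L ^ (1 / q)) := by
    refine h3.trans ?_
    rw [ENNReal.ofReal_mul ENNReal.toReal_nonneg, ENNReal.ofReal_toReal hAt,
      ← ENNReal.ofReal_rpow_of_pos hL]
    gcongr
  have h5 := (ENNReal.ofReal_le_ofReal_iff (by positivity)).1 h4
  have h6 : ‖f 0‖ ≤ ‖f 0‖ / Real.log 2 ^ (1 / q) * L ^ (1 / q) := by
    rw [div_mul_eq_mul_div, le_div_iff₀ (by positivity)]
    gcongr
  calc ‖f z‖ = ‖(f z - f 0) + f 0‖ := by simp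
    _ ≤ ‖f z - f 0‖ + ‖f 0‖ := norm_add_le _ _
    _ ≤ _ := by rw [add_mul]; linarith

/-! ### Synthesis of Besov functions from `ℓ¹` coefficients -/

lemma ENNReal.tsum_mul_rpow_le {ι : Type*} {p : ℝ} (hp : 1 ≤ p) (w x : ι → ENNReal) :
    (∑' i, w i * x i) ^ p ≤ (∑' i, w i) ^ (p - 1) * ∑' i, w i * x i ^ p := by
  have hp0 : 0 < p := by linarith
  have h : ∑' i, w i * x i ≤ (∑' i, w i) ^ (1 - p⁻¹) * (∑' i, w i * x i ^ p) ^ p⁻¹ := by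
    rw [ENNReal.tsum_eq_iSup_sum (f := fun i => w i * x i)]
    refine iSup_le fun s => (ENNReal.inner_le_weight_mul_Lp_of_nonneg s hp w x).trans ?_
    have h1 : 0 ≤ 1 - p⁻¹ := sub_nonneg.2 (inv_le_one_of_one_le₀ hp)
    have h2 : 0 ≤ p⁻¹ := by positivity
    exact mul_le_mul' (ENNReal.rpow_le_rpow (ENNReal.sum_le_tsum s) h1)
      (ENNReal.rpow_le_rpow (ENNReal.sum_le_tsum s) h2)
  refine (ENNReal.rpow_le_rpow h hp0.le).trans_eq ?_
  rw [ENNReal.mul_rpow_of_nonneg _ _ hp0.le, ← ENNReal.rpow_mul, ← ENNReal.rpow_mul,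
    inv_mul_cancel₀ hp0.ne', ENNReal.rpow_one, sub_mul, one_mul, inv_mul_cancel₀ hp0.ne']

lemma ofReal_mul_norm_rpow {a p : ℝ} (ha : 0 ≤ a) (hp : 0 ≤ p) (x : ℂ) :
    ENNReal.ofReal (a * ‖x‖ ^ p) = ENNReal.ofReal a * ‖x‖ₑ ^ p := by
  rw [ENNReal.ofReal_mul ha, ← ofReal_norm, ENNReal.ofReal_rpow_of_nonneg (norm_nonneg _) hp]

section Synthesis

variable {F : ℕ → ℂ → ℂ} {c : ℕ → ℂ}

lemma norm_mul_le_of_locally_bounded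
    (hloc : ∀ r < 1, ∃ M, ∀ n, ∀ z ∈ Metric.ball (0 : ℂ) r, ‖F n z‖ ≤ M)
    (hc : Summable fun n => ‖c n‖) {z : ℂ} (hz : z ∈ unitDisk) :
    ∃ r ≤ (1 : ℝ), z ∈ Metric.ball (0 : ℂ) r ∧ ∃ u : ℕ → ℝ, Summable u ∧
      ∀ n, ∀ w ∈ Metric.ball (0 : ℂ) r, ‖c n * F n w‖ ≤ u n := by
  rw [mem_unitDisk] at hz
  obtain ⟨M, hM⟩ := hloc ((1 + ‖z‖) / 2) (by linarith)
  refine ⟨(1 + ‖z‖) / 2, by linarith, by simp; linarith, fun n => ‖c n‖ * M, hc.mul_right M, ?_⟩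
  intro n w hw
  rw [norm_mul]
  exact mul_le_mul_of_nonneg_left (hM n w hw) (norm_nonneg _)

lemma tsum_mem_holDisk (hF : ∀ n, F n ∈ HolDisk)
    (hloc : ∀ r < 1, ∃ M, ∀ n, ∀ z ∈ Metric.ball (0 : ℂ) r, ‖F n z‖ ≤ M)
    (hc : Summable fun n => ‖c n‖) : (fun z => ∑' n, c n * F n z) ∈ HolDisk := by
  intro z hz
  obtain ⟨r, hr, hzr, u, hu, hle⟩ := norm_mul_le_of_locally_bounded hloc hc hz
  have := Complex.differentiableOn_tsum_of_summable_norm hu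
    (fun n => ((hF n).mono (Metric.ball_subset_ball hr)).const_mul (c n)) Metric.isOpen_ball hle
  exact (this.differentiableAt (Metric.isOpen_ball.mem_nhds hzr)).differentiableWithinAt

lemma hasSum_mul_tsum
    (hloc : ∀ r < 1, ∃ M, ∀ n, ∀ z ∈ Metric.ball (0 : ℂ) r, ‖F n z‖ ≤ M)
    (hc : Summable fun n => ‖c n‖) {z : ℂ} (hz : z ∈ unitDisk) :
    HasSum (fun n => c n * F n z) (∑' n, c n * F n z) := by
  obtain ⟨r, hr, hzr, u, hu, hle⟩ := norm_mul_le_of_locally_bounded hloc hc hz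
  exact (Summable.of_norm_bounded hu fun n => hle n z hzr).hasSum

lemma hasSum_deriv_tsum (hF : ∀ n, F n ∈ HolDisk)
    (hloc : ∀ r < 1, ∃ M, ∀ n, ∀ z ∈ Metric.ball (0 : ℂ) r, ‖F n z‖ ≤ M)
    (hc : Summable fun n => ‖c n‖) {z : ℂ} (hz : z ∈ unitDisk) :
    HasSum (fun n => c n * deriv (F n) z) (deriv (fun z => ∑' n, c n * F n z) z) := by
  obtain ⟨r, hr, hzr, u, hu, hle⟩ := norm_mul_le_of_locally_bounded hloc hc hz
  have := Complex.hasSum_deriv_of_summable_norm hu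
    (fun n => ((hF n).mono (Metric.ball_subset_ball hr)).const_mul (c n)) Metric.isOpen_ball hle hzr
  convert! this using 1
  ext n
  exact (deriv_const_mul _ ((hF n).differentiableAt (isOpen_unitDisk.mem_nhds hz))).symm

/-- Hölder with weights `|c_n|` bounds `|∑ c_n F_n'|^p` pointwise by `(∑ |c_n|)^(p-1) ∑ |c_n|
|F_n'|^p`; integrating term by term leaves a finite multiple of `K`. -/
lemma besovEnergy_tsum_lt_top {p : ℝ} (hp : 1 < p) (hF : ∀ n, F n ∈ HolDisk)
    (hloc : ∀ r < 1, ∃ M, ∀ n, ∀ z ∈ Metric.ball (0 : ℂ) r, ‖F n z‖ ≤ M)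
    {K : ENNReal} (hK : K < ⊤) (hE : ∀ n, besovEnergy p (deriv (F n)) ≤ K)
    (hc : Summable fun n => ‖c n‖) :
    besovEnergy p (deriv fun z => ∑' n, c n * F n z) < ⊤ := by
  have hp0 : 0 < p := by linarith
  set A : ENNReal := ∑' n, ‖c n‖ₑ with hA
  have hAt : A ≠ ⊤ := by
    have := hc.tsum_ofReal_ne_top
    simpa only [ofReal_norm] using this
  have hnn : ∀ z ∈ unitDisk, 0 ≤ (1 - ‖z‖) ^ (p - 2) := fun z hz => by
    rw [mem_unitDisk] at hz
    have : 0 ≤ 1 - ‖z‖ := by linarith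
    positivity
  calc besovEnergy p (deriv fun z => ∑' n, c n * F n z)
      ≤ ∫⁻ z in unitDisk, A ^ (p - 1) * ∑' n, ‖c n‖ₑ *
          ENNReal.ofReal ((1 - ‖z‖) ^ (p - 2) * ‖deriv (F n) z‖ ^ p) := by
        refine setLIntegral_mono' isOpen_unitDisk.measurableSet fun z hz => ?_
        rw [ofReal_mul_norm_rpow (hnn z hz) hp0.le]
        simp only [ofReal_mul_norm_rpow (hnn z hz) hp0.le, mul_left_comm (‖c _‖ₑ),
          ENNReal.tsum_mul_left]
        rw [mul_left_comm]
        gcongr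
        refine le_trans ?_ (ENNReal.tsum_mul_rpow_le hp.le _ _)
        gcongr
        rw [← (hasSum_deriv_tsum hF hloc hc hz).tsum_eq]
        refine enorm_tsum_le_tsum_enorm.trans_eq ?_
        simp only [enorm_mul]
    _ = A ^ (p - 1) * ∑' n, ‖c n‖ₑ * besovEnergy p (deriv (F n)) := by
        rw [lintegral_const_mul' _ _ (ENNReal.rpow_ne_top_of_nonneg (by linarith) hAt),
          lintegral_tsum]
        · congr 2
          ext n
          rw [lintegral_const_mul' _ _ enorm_ne_top]
          rfl
        · intro n
          refine AEMeasurable.const_mul ?_ _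
          exact (ENNReal.continuous_ofReal.comp_continuousOn (continuousOn_one_sub_norm_rpow_mul
            (HolDisk.deriv_mem (hF n)) hp0.le _)).aemeasurable isOpen_unitDisk.measurableSet
    _ ≤ A ^ (p - 1) * (A * K) := by
        rw [hA, ← ENNReal.tsum_mul_right]
        gcongr with n
        exact hE n
    _ < ⊤ := ENNReal.mul_lt_top
        (ENNReal.rpow_ne_top_of_nonneg (by linarith) hAt).lt_top
        (ENNReal.mul_lt_top hAt.lt_top hK)

end Synthesis

/-! ### Uniform boundedness through `ℓ¹` -/

lemma lp_one_summable_norm (c : lp (fun _ : ℕ => ℂ) 1) : Summable fun n => ‖c n‖ := by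
  simpa using (memℓp_gen_iff (by simp)).1 (lp.memℓp c)

/-- The functional on `ℓ¹` given by pairing with a bounded sequence. -/
noncomputable def lpOnePairing (b : ℕ → ℂ) {M : ℝ} (hb : ∀ n, ‖b n‖ ≤ M) :
    lp (fun _ : ℕ => ℂ) 1 →L[ℂ] ℂ :=
  have hs : ∀ c : lp (fun _ : ℕ => ℂ) 1, Summable fun n => c n * b n := fun c =>
    Summable.of_norm_bounded ((lp_one_summable_norm c).mul_right M) fun n => by
      rw [norm_mul]
      gcongr
      exact hb n
  LinearMap.mkContinuous
    { toFun := fun c => ∑' n, c n * b n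
      map_add' := fun c d => by
        simp only [lp.coeFn_add, Pi.add_apply, add_mul]
        exact (hs c).tsum_add (hs d)
      map_smul' := fun a c => by
        simp only [lp.coeFn_smul, Pi.smul_apply, smul_eq_mul, mul_assoc, RingHom.id_apply]
        exact tsum_mul_left } M fun c => by
    have h1 : ‖c‖ = ∑' n, ‖c n‖ := by
      rw [lp.norm_eq_tsum_rpow (by simp)]
      simp
    rw [h1, ← tsum_mul_left]
    refine tsum_of_norm_bounded ((lp_one_summable_norm c).mul_left M).hasSum fun n => ?_
    rw [norm_mul, mul_comm]
    gcongr
    exact hb n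

lemma lpOnePairing_apply {b : ℕ → ℂ} {M : ℝ} (hb : ∀ n, ‖b n‖ ≤ M)
    (c : lp (fun _ : ℕ => ℂ) 1) : lpOnePairing b hb c = ∑' n, c n * b n := rfl

lemma exists_locally_bounded_of_besovEnergy_le {p : ℝ} (hp : 1 < p) {ι : Type*} {F : ι → ℂ → ℂ}
    (hF : ∀ i, F i ∈ HolDisk) {M : ℝ} (hM : ∀ i, ‖F i 0‖ ≤ M) {K : ENNReal} (hK : K < ⊤)
    (hE : ∀ i, besovEnergy p (deriv (F i)) ≤ K) {r : ℝ} (hr : r < 1) :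
    ∃ M', ∀ i, ∀ z ∈ Metric.ball (0 : ℂ) r, ‖F i z‖ ≤ M' := by
  have hpq := Real.HolderConjugate.conjExponent hp
  set q := Real.conjExponent p
  have hq := hpq.symm.pos
  set B := (ENNReal.ofReal (8 / Real.pi * 2 ^ |p - 3|) * K) ^ (1 / p) *
    ENNReal.ofReal (Real.log (1 / (1 - r))) ^ (1 / q) with hB
  have hBt : B ≠ ⊤ := ENNReal.mul_ne_top
    (ENNReal.rpow_ne_top_of_nonneg (by positivity)
      (ENNReal.mul_lt_top ENNReal.ofReal_lt_top hK).ne)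
    (ENNReal.rpow_ne_top_of_nonneg (by positivity) ENNReal.ofReal_ne_top)
  refine ⟨B.toReal + M, fun i z hz => ?_⟩
  rw [mem_ball_zero_iff] at hz
  have h1 := ofReal_norm_sub_le_besovEnergy (hF i) hpq (mem_unitDisk.2 (hz.trans hr))
  have h2 : ENNReal.ofReal ‖F i z - F i 0‖ ≤ B := by
    refine h1.trans ?_
    rw [hB]
    have : 0 < 1 - ‖z‖ := by linarith
    have : 0 < 1 - r := by linarith
    gcongr
    exact hE i
  have h3 := (ENNReal.ofReal_le_iff_le_toReal hBt).1 h2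
  calc ‖F i z‖ = ‖(F i z - F i 0) + F i 0‖ := by simp
    _ ≤ _ := (norm_add_le _ _).trans (add_le_add h3 (hM i))

/-- **Uniform boundedness**: if the first order differential operator `A f + B f'` maps `B^p` to
bounded functions, then it is bounded uniformly on energy-bounded families. -/
lemma exists_uniform_bound_of_besov {p : ℝ} (hp : 1 < p) {A B : ℂ → ℂ}
    (hAB : ∀ f ∈ Besov p, ∃ C, ∀ z ∈ unitDisk, ‖A z * f z + B z * deriv f z‖ ≤ C)
    {ι : Type*} {F : ι → ℂ → ℂ} (hF : ∀ i, F i ∈ HolDisk) {M : ℝ} (hM : ∀ i, ‖F i 0‖ ≤ M)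
    {K : ENNReal} (hK : K < ⊤) (hE : ∀ i, besovEnergy p (deriv (F i)) ≤ K) :
    ∃ C, ∀ i, ∀ z ∈ unitDisk, ‖A z * F i z + B z * deriv (F i) z‖ ≤ C := by
  by_contra! hcon
  -- If uniformity fails, there are for each `n` a member of the family and a point where the
  -- operator exceeds `n`.
  choose i z hz hlt using fun n : ℕ => hcon n
  set G : ℕ → ℂ → ℂ := fun n => F (i n)
  have hG : ∀ n, G n ∈ HolDisk := fun n => hF (i n)
  have hloc : ∀ r < 1, ∃ M, ∀ n, ∀ z ∈ Metric.ball (0 : ℂ) r, ‖G n z‖ ≤ M := fun r hr =>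
    exists_locally_bounded_of_besovEnergy_le hp hG (fun n => hM (i n)) hK (fun n => hE (i n)) hr
  obtain ⟨D, hD⟩ := one_sub_norm_mul_norm_le hp hK
  -- At a fixed point `z m` the values are bounded in `n`, so they define a continuous functional on
  -- `ℓ¹`.
  have hb : ∀ m, ∃ M, ∀ n, ‖A (z m) * G n (z m) + B (z m) * deriv (G n) (z m)‖ ≤ M := by
    intro m
    have hzm := mem_unitDisk.1 (hz m)
    obtain ⟨M', hM'⟩ := hloc ((1 + ‖z m‖) / 2) (by linarith)
    refine ⟨‖A (z m)‖ * M' + ‖B (z m)‖ * (D / (1 - ‖z m‖)), fun n => ?_⟩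
    refine (norm_add_le _ _).trans ?_
    rw [norm_mul, norm_mul]
    gcongr
    · exact hM' n _ (by simp; linarith)
    · rw [le_div_iff₀ (by linarith), mul_comm]
      exact hD _ (HolDisk.deriv_mem (hG n)) (hE (i n)) _ (hz m)
  choose N hN using hb
  obtain ⟨C, hC⟩ := banach_steinhaus (g := fun m => lpOnePairing _ (hN m)) (by
    intro c
    have hc := lp_one_summable_norm c
    obtain ⟨C, hC⟩ := hAB (fun z => ∑' n, c n * G n z) ((mem_besov_iff hp).2
      ⟨tsum_mem_holDisk hG hloc hc,
        besovEnergy_tsum_lt_top hp hG hloc hK (fun n => hE (i n)) hc⟩)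
    refine ⟨C, fun m => ?_⟩
    have h1 := ((hasSum_mul_tsum hloc hc (hz m)).mul_left (A (z m))).add
      ((hasSum_deriv_tsum hG hloc hc (hz m)).mul_left (B (z m)))
    have h2 := hC _ (hz m)
    rw [← h1.tsum_eq] at h2
    rw [lpOnePairing_apply]
    convert! h2 using 4 with n
    ring)
  obtain ⟨n, hn⟩ := exists_nat_gt C
  -- The `n`-th functional on the `n`-th unit vector returns the value exceeding `n`, and `n > C`.
  have h1 := (lpOnePairing _ (hN n)).le_opNorm (lp.single 1 n 1)
  rw [lp.norm_single (by simp), norm_one, mul_one, lpOnePairing_apply,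
    tsum_eq_single n fun m hm => by simp [lp.single_apply, hm]] at h1
  have h2 : ‖A (z n) * G n (z n) + B (z n) * deriv (G n) (z n)‖ ≤ C := by
    simpa using h1.trans (hC n)
  linarith [hlt n]

/-! ### Integrals of powers of the Cauchy kernel -/

/-- Moving from `s e^{iθ}` to `e^{iθ}` costs `1 - s`, itself at most the norm on the right; and `|1
- e^{iθ}| = 2|sin(θ/2)| ≥ 2|θ|/π`. -/
lemma abs_le_pi_mul_norm_one_sub {s θ : ℝ} (hs0 : 0 ≤ s) (hs1 : s ≤ 1) (hθ : |θ| ≤ Real.pi) :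
    |θ| ≤ Real.pi * ‖1 - s * Complex.exp (θ * Complex.I)‖ := by
  have hπ := Real.pi_pos
  set u := Complex.exp (θ * Complex.I)
  have hu : ‖u‖ = 1 := Complex.norm_exp_ofReal_mul_I θ
  have h1 : 1 - s ≤ ‖1 - s * u‖ := by
    have := norm_sub_norm_le (1 : ℂ) (s * u)
    rwa [norm_one, norm_mul, hu, Complex.norm_real, Real.norm_of_nonneg hs0, mul_one] at this
  have h2 : ‖1 - u‖ ≤ ‖1 - s * u‖ + (1 - s) := by
    have : ‖((s : ℂ) - 1) * u‖ = 1 - s := by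
      rw [norm_mul, hu, mul_one, ← Complex.ofReal_one, ← Complex.ofReal_sub, Complex.norm_real,
        Real.norm_eq_abs, abs_of_nonpos (by linarith)]
      ring
    rw [← this]
    refine le_trans (le_of_eq ?_) (norm_add_le _ _)
    congr 1
    ring
  have h3 : ‖1 - u‖ = 2 * |Real.sin (θ / 2)| := by
    rw [norm_sub_rev, show u = Complex.exp (Complex.I * θ) by rw [mul_comm], Complex.norm_exp_I_mul_ofReal_sub_one]
    simp
  have h4 : 2 / Real.pi * |θ / 2| ≤ |Real.sin (θ / 2)| :=
    Real.mul_abs_le_abs_sin (by rw [abs_div, abs_two]; linarith)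
  rw [abs_div, abs_two] at h4
  have h5 : 2 / Real.pi * (|θ| / 2) = |θ| / Real.pi := by field_simp
  rw [h5, div_le_iff₀ hπ] at h4
  nlinarith

/-- The kernel's denominator dominates both `1 - s` and `|θ|/π`, hence `(1 - s + |θ|)/(1 + π)`,
whose power `-q` has an elementary integral. -/
lemma lintegral_norm_one_sub_rpow_le {q : ℝ} (hq : 1 < q) {s : ℝ} (hs0 : 0 ≤ s) (hs1 : s < 1) :
    ∫⁻ θ in Ioo (-Real.pi) Real.pi,
      ENNReal.ofReal (‖1 - s * Complex.exp (θ * Complex.I)‖ ^ (-q)) ≤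
    ENNReal.ofReal (2 * (1 + Real.pi) ^ q / (q - 1) * (1 - s) ^ (1 - q)) := by
  have hπ := Real.pi_pos
  have hδ : 0 < 1 - s := by linarith
  set k : ℝ → ENNReal := fun t =>
    ENNReal.ofReal ((1 + Real.pi) ^ q * (1 - s + t) ^ (-q)) with hk
  have hle : ∀ θ ∈ Ioo (-Real.pi) Real.pi,
      ENNReal.ofReal (‖1 - s * Complex.exp (θ * Complex.I)‖ ^ (-q)) ≤ k |θ| := by
    intro θ hθ
    refine ENNReal.ofReal_le_ofReal ?_
    have h1 := abs_le_pi_mul_norm_one_sub hs0 hs1.le (abs_le.2 ⟨hθ.1.le, hθ.2.le⟩)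
    have h2 : 1 - s ≤ ‖1 - s * Complex.exp (θ * Complex.I)‖ := by
      have := norm_sub_norm_le (1 : ℂ) (s * Complex.exp (θ * Complex.I))
      rwa [norm_one, norm_mul, Complex.norm_exp_ofReal_mul_I, Complex.norm_real,
        Real.norm_of_nonneg hs0, mul_one] at this
    have h3 : (1 - s + |θ|) / (1 + Real.pi) ≤ ‖1 - s * Complex.exp (θ * Complex.I)‖ := by
      rw [div_le_iff₀ (by positivity)]
      linarith
    have h4 : 0 < 1 - s + |θ| := by positivity
    calc ‖1 - s * Complex.exp (θ * Complex.I)‖ ^ (-q)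
        ≤ ((1 - s + |θ|) / (1 + Real.pi)) ^ (-q) :=
          Real.rpow_le_rpow_of_nonpos (by positivity) h3 (by linarith)
      _ = (1 + Real.pi) ^ q * (1 - s + |θ|) ^ (-q) := by
          rw [Real.div_rpow h4.le (by positivity), Real.rpow_neg (x := 1 + Real.pi) (by positivity)]
          field_simp
  have hhalf : ∫⁻ t in Ioo 0 Real.pi, k t ≤
      ENNReal.ofReal ((1 + Real.pi) ^ q / (q - 1) * (1 - s) ^ (1 - q)) := by
    rw [hk, lintegral_Ioo_ofReal_of_hasDerivAt
      (G := fun t => -((1 + Real.pi) ^ q / (q - 1)) * (1 - s + t) ^ (1 - q)) hπ.le]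
    · refine ENNReal.ofReal_le_ofReal ?_
      have : 0 ≤ (1 + Real.pi) ^ q / (q - 1) * (1 - s + Real.pi) ^ (1 - q) := by
        have : 0 < q - 1 := by linarith
        positivity
      rw [add_zero]
      linarith
    · refine continuousOn_const.mul (ContinuousOn.rpow_const (by fun_prop) fun t ht => Or.inl ?_)
      linarith [ht.1]
    · intro t ht
      have hne : 1 - s + t ≠ 0 := by linarith [ht.1]
      have h1 := (((hasDerivAt_id t).const_add (1 - s)).rpow_const (p := 1 - q)
        (Or.inl hne)).const_mul (-((1 + Real.pi) ^ q / (q - 1)))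
      convert! h1 using 1
      have : q - 1 ≠ 0 := by linarith
      rw [show 1 - q - 1 = -q by ring]
      simp only [id]
      field_simp
      ring
    · intro t ht
      have : 0 < 1 - s + t := by linarith [ht.1]
      positivity
  have hneg : ∫⁻ θ in Ioo (-Real.pi) 0, k |θ| = ∫⁻ t in Ioo 0 Real.pi, k t := by
    rw [← (Measure.measurePreserving_neg (volume : Measure ℝ)).setLIntegral_comp_preimage_emb
      (MeasurableEquiv.neg ℝ).measurableEmbedding k (Ioo 0 Real.pi)]
    simp only [neg_Ioo, Set.neg_preimage, neg_zero]
    refine setLIntegral_congr_fun measurableSet_Ioo fun θ hθ => ?_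
    simp only [abs_of_neg hθ.2]
  have hpos : ∫⁻ θ in Ico 0 Real.pi, k |θ| = ∫⁻ t in Ioo 0 Real.pi, k t := by
    rw [setLIntegral_congr Ioo_ae_eq_Ico.symm]
    refine setLIntegral_congr_fun measurableSet_Ioo fun θ hθ => ?_
    simp only [abs_of_pos hθ.1]
  calc _ ≤ ∫⁻ θ in Ioo (-Real.pi) Real.pi, k |θ| := setLIntegral_mono' measurableSet_Ioo hle
    _ ≤ (∫⁻ θ in Ioo (-Real.pi) 0, k |θ|) + ∫⁻ θ in Ico 0 Real.pi, k |θ| := by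
        rw [← Ioo_union_Ico_eq_Ioo (a := -Real.pi) (b := 0) (by linarith) hπ.le]
        exact lintegral_union_le _ _ _
    _ = 2 * ∫⁻ t in Ioo 0 Real.pi, k t := by rw [hneg, hpos, two_mul]
    _ ≤ 2 * ENNReal.ofReal ((1 + Real.pi) ^ q / (q - 1) * (1 - s) ^ (1 - q)) := by gcongr
    _ = _ := by
        rw [← ENNReal.ofReal_ofNat, ← ENNReal.ofReal_mul (by norm_num)]
        congr 1
        ring

lemma lintegral_unitDisk_rotate (k : ℂ → ENNReal) {u : ℂ} (hu : ‖u‖ = 1) :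
    ∫⁻ z in unitDisk, k (u * z) = ∫⁻ z in unitDisk, k z := by
  set U : Circle := ⟨u, by simpa [Submonoid.unitSphere] using hu⟩
  have hU : ‖(U : ℂ)‖ = 1 := hu
  have h := (rotation U).measurePreserving
  rw [← h.setLIntegral_comp_preimage_emb
    (rotation U).toMeasurableEquiv.measurableEmbedding k unitDisk]
  have : (rotation U) ⁻¹' unitDisk = unitDisk := by
    ext z
    simp [mem_unitDisk, hU]
  rw [this]
  rfl

/-- The weighted integral of a power of the Cauchy kernel, reduced to a radial integral. -/
lemma lintegral_cauchy_kernel_le {p q : ℝ} (hq : 1 < q) {a : ℂ} (ha : a ∈ unitDisk) :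
    ∫⁻ z in unitDisk, ENNReal.ofReal ((1 - ‖z‖) ^ (p - 2) * ‖1 - star a * z‖ ^ (-q)) ≤
      ENNReal.ofReal (2 * (1 + Real.pi) ^ q / (q - 1)) * ∫⁻ r in Ioo (0 : ℝ) 1,
        ENNReal.ofReal ((1 - r) ^ (p - 2) * (1 - ‖a‖ * r) ^ (1 - q)) := by
  rw [mem_unitDisk] at ha
  obtain ⟨u, hu, hau⟩ : ∃ u : ℂ, ‖u‖ = 1 ∧ star a * u = (‖a‖ : ℝ) := by
    refine ⟨Complex.exp (a.arg * Complex.I), by simp [Complex.norm_exp], ?_⟩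
    set u := Complex.exp (a.arg * Complex.I) with hu
    have h1 : a = ‖a‖ * u := (Complex.norm_mul_exp_arg_mul_I a).symm
    have h2 : star u * u = 1 := by
      rw [Complex.star_def, Complex.conj_mul', Complex.norm_exp_ofReal_mul_I]
      simp
    calc star a * u = star ((‖a‖ : ℂ) * u) * u := by rw [← h1]
      _ = ‖a‖ * (star u * u) := by simp [mul_assoc]
      _ = _ := by rw [h2, mul_one]
  set ρ := ‖a‖ with hρ
  have hρ0 : 0 ≤ ρ := norm_nonneg a
  have hnz : ∀ z ∈ unitDisk, 1 - (ρ : ℂ) * z ≠ 0 := by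
    intro z hz h0
    rw [mem_unitDisk] at hz
    have : ‖(ρ : ℂ) * z‖ = 1 := by rw [← sub_eq_zero.1 h0, norm_one]
    rw [norm_mul, Complex.norm_real, Real.norm_of_nonneg hρ0] at this
    nlinarith [norm_nonneg z]
  rw [← lintegral_unitDisk_rotate _ hu]
  simp only [← mul_assoc, hau, norm_mul, hu, one_mul]
  have hcont : ContinuousOn (fun z : ℂ =>
      ENNReal.ofReal ((1 - ‖z‖) ^ (p - 2) * ‖1 - (ρ : ℂ) * z‖ ^ (-q))) (Metric.ball 0 1) := by
    refine ENNReal.continuous_ofReal.comp_continuousOn (ContinuousOn.mul ?_ ?_)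
    · refine ContinuousOn.rpow_const (by fun_prop) fun w hw => Or.inl ?_
      rw [mem_ball_zero_iff] at hw
      linarith
    · exact ContinuousOn.rpow_const (by fun_prop) fun w hw => Or.inl (norm_ne_zero_iff.2 (hnz w hw))
  rw [unitDisk, lintegral_ball_eq_polar hcont, ← lintegral_const_mul' _ _ ENNReal.ofReal_ne_top]
  refine setLIntegral_mono' measurableSet_Ioo fun r hr => ?_
  have hr1 : 0 < 1 - r := by linarith [hr.2]
  have hs1 : ρ * r < 1 := by nlinarith [hr.1, hr.2]
  have hnr : ∀ θ : ℝ, ‖(r : ℂ) * Complex.exp (θ * Complex.I)‖ = r := fun θ => by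
    rw [norm_mul, Complex.norm_exp_ofReal_mul_I, Complex.norm_real, Real.norm_of_nonneg hr.1.le,
      mul_one]
  simp only [hnr, ENNReal.ofReal_mul (Real.rpow_nonneg hr1.le (p - 2))]
  rw [lintegral_const_mul' _ _ ENNReal.ofReal_ne_top]
  have hang := lintegral_norm_one_sub_rpow_le hq (mul_nonneg hρ0 hr.1.le) hs1
  simp only [Complex.ofReal_mul, mul_assoc] at hang
  -- The polar Jacobian `r` is simply bounded by 1.
  calc _ ≤ 1 * (ENNReal.ofReal ((1 - r) ^ (p - 2)) * ENNReal.ofReal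
        (2 * (1 + Real.pi) ^ q / (q - 1) * (1 - ρ * r) ^ (1 - q))) := by
        gcongr
        rw [← ENNReal.ofReal_one]
        exact ENNReal.ofReal_le_ofReal hr.2.le
    _ = _ := by
        have : 0 < q - 1 := by linarith
        rw [one_mul, ENNReal.ofReal_mul (p := 2 * (1 + Real.pi) ^ q / (q - 1)) (by positivity)]
        ring

lemma lintegral_Ioo_one_sub_rpow {ρ s : ℝ} (h0 : 0 ≤ ρ) (h1 : ρ < 1) (hs : s ≠ 0) :
    ∫⁻ r in Ioo 0 ρ, ENNReal.ofReal ((1 - r) ^ (-s - 1)) =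
      ENNReal.ofReal (((1 - ρ) ^ (-s) - 1) / s) := by
  rw [lintegral_Ioo_ofReal_of_hasDerivAt (G := fun r => (1 - r) ^ (-s) / s) h0]
  · simp [sub_div]
  · refine ContinuousOn.div_const (ContinuousOn.rpow_const (by fun_prop) fun x hx => Or.inl ?_) _
    linarith [hx.2]
  · intro x hx
    have hx1 : 1 - x ≠ 0 := by linarith [hx.2]
    have := (((hasDerivAt_id x).const_sub 1).rpow_const (p := -s) (Or.inl hx1)).div_const s
    convert! this using 1
    simp only [id]
    field_simp
  · intro x hx
    have : 0 < 1 - x := by linarith [hx.2]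
    positivity

lemma lintegral_Ioo_one_sub_rpow_tail {ρ p : ℝ} (h1 : ρ < 1) (hp : 1 < p) :
    ∫⁻ r in Ioo ρ 1, ENNReal.ofReal ((1 - r) ^ (p - 2)) =
      ENNReal.ofReal ((1 - ρ) ^ (p - 1) / (p - 1)) := by
  have hp' : p - 1 ≠ 0 := by linarith
  rw [lintegral_Ioo_ofReal_of_hasDerivAt (G := fun r => -((1 - r) ^ (p - 1) / (p - 1))) h1.le]
  · simp [Real.zero_rpow hp']
  · refine (ContinuousOn.div_const (ContinuousOn.rpow_const (by fun_prop) fun x hx => Or.inr ?_)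
      _).neg
    linarith
  · intro x hx
    have hx1 : 1 - x ≠ 0 := by linarith [hx.2]
    have := ((((hasDerivAt_id x).const_sub 1).rpow_const (p := p - 1)
      (Or.inl hx1)).div_const (p - 1)).neg
    convert! this using 1
    rw [show p - 1 - 1 = p - 2 by ring]
    simp only [id]
    field_simp
  · intro x hx
    have : 0 < 1 - x := by linarith [hx.2]
    positivity

/-- Split at `r = ρ`: below, `1 - ρr ≥ 1 - r`; above, `1 - ρr ≥ 1 - ρ`. The first integral is left
unevaluated because it is a power for `q = 2p` but a logarithm for `q = p`. -/
lemma lintegral_radial_kernel_le {ρ p q : ℝ} (h0 : 0 ≤ ρ) (h1 : ρ < 1) (hp : 1 < p)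
    (hq : 1 < q) :
    ∫⁻ r in Ioo (0 : ℝ) 1, ENNReal.ofReal ((1 - r) ^ (p - 2) * (1 - ρ * r) ^ (1 - q)) ≤
      (∫⁻ r in Ioo 0 ρ, ENNReal.ofReal ((1 - r) ^ (p - q - 1))) +
        ENNReal.ofReal ((1 - ρ) ^ (p - q) / (p - 1)) := by
  have hδ : 0 < 1 - ρ := by linarith
  have hρr : ∀ r : ℝ, 0 ≤ r → r < 1 → 0 < 1 - ρ * r := fun r hr0 hr1 => by nlinarith
  have hsplit : Ioo (0 : ℝ) 1 ⊆ Ioc 0 ρ ∪ Ioo ρ 1 := by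
    intro r hr
    rcases le_or_gt r ρ with h | h
    · exact Or.inl ⟨hr.1, h⟩
    · exact Or.inr ⟨h, hr.2⟩
  refine (lintegral_mono_set hsplit).trans ((lintegral_union_le _ _ _).trans (add_le_add ?_ ?_))
  · rw [setLIntegral_congr Ioo_ae_eq_Ioc.symm]
    refine setLIntegral_mono' measurableSet_Ioo fun r hr => ENNReal.ofReal_le_ofReal ?_
    have hr1 : 0 < 1 - r := by linarith [hr.2]
    calc (1 - r) ^ (p - 2) * (1 - ρ * r) ^ (1 - q)
        ≤ (1 - r) ^ (p - 2) * (1 - r) ^ (1 - q) := by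
          gcongr ?_ * ?_
          refine Real.rpow_le_rpow_of_nonpos hr1 ?_ (by linarith)
          nlinarith [hr.1]
      _ = _ := by
          rw [← Real.rpow_add hr1]
          congr 1
          ring
  · calc ∫⁻ r in Ioo ρ 1, ENNReal.ofReal ((1 - r) ^ (p - 2) * (1 - ρ * r) ^ (1 - q))
        ≤ ∫⁻ r in Ioo ρ 1, ENNReal.ofReal ((1 - ρ) ^ (1 - q)) *
            ENNReal.ofReal ((1 - r) ^ (p - 2)) := by
          refine setLIntegral_mono' measurableSet_Ioo fun r hr => ?_
          have hr1 : 0 < 1 - r := by linarith [hr.2]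
          rw [← ENNReal.ofReal_mul (by positivity), mul_comm ((1 - r) ^ (p - 2))]
          refine ENNReal.ofReal_le_ofReal ?_
          gcongr ?_ * ?_
          refine Real.rpow_le_rpow_of_nonpos hδ ?_ (by linarith)
          nlinarith [hr.1]
      _ = _ := by
          rw [lintegral_const_mul' _ _ ENNReal.ofReal_ne_top,
            lintegral_Ioo_one_sub_rpow_tail h1 hp, ← ENNReal.ofReal_mul (by positivity),
            mul_div_assoc', ← Real.rpow_add hδ]
          congr 3
          ring

lemma one_sub_star_mul_mem_slitPlane {a z : ℂ} (ha : a ∈ unitDisk) (hz : z ∈ unitDisk) :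
    1 - star a * z ∈ Complex.slitPlane := by
  rw [mem_unitDisk] at ha hz
  refine Or.inl ?_
  have h1 : (star a * z).re ≤ ‖star a * z‖ := Complex.re_le_norm _
  rw [norm_mul, norm_star] at h1
  have : ‖a‖ * ‖z‖ < 1 := by nlinarith [norm_nonneg a, norm_nonneg z]
  rw [Complex.sub_re, Complex.one_re]
  linarith

lemma one_sub_norm_sq_pos {a : ℂ} (ha : a ∈ unitDisk) : 0 < 1 - ‖a‖ ^ 2 := by
  rw [mem_unitDisk] at ha
  nlinarith [norm_nonneg a]

lemma one_sub_star_mul_self (a : ℂ) : 1 - star a * a = ((1 - ‖a‖ ^ 2 : ℝ) : ℂ) := by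
  rw [Complex.star_def, Complex.conj_mul']
  simp

lemma besovEnergy_le_of_cauchy_kernel {p q : ℝ} (hp : 1 < p) (hq : 1 < q) {a : ℂ}
    (ha : a ∈ unitDisk) {b : ℝ} (hb : 0 ≤ b) {h : ℂ → ℂ}
    (hh : ∀ z ∈ unitDisk, ‖h z‖ ^ p ≤ b * ‖1 - star a * z‖ ^ (-q)) :
    besovEnergy p h ≤ ENNReal.ofReal b * (ENNReal.ofReal (2 * (1 + Real.pi) ^ q / (q - 1)) *
      ((∫⁻ r in Ioo 0 ‖a‖, ENNReal.ofReal ((1 - r) ^ (p - q - 1))) +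
        ENNReal.ofReal ((1 - ‖a‖) ^ (p - q) / (p - 1)))) := by
  calc besovEnergy p h ≤ ∫⁻ z in unitDisk, ENNReal.ofReal b *
          ENNReal.ofReal ((1 - ‖z‖) ^ (p - 2) * ‖1 - star a * z‖ ^ (-q)) := by
        refine setLIntegral_mono' isOpen_unitDisk.measurableSet fun z hz => ?_
        rw [← ENNReal.ofReal_mul hb, mul_left_comm]
        have : 0 ≤ 1 - ‖z‖ := by rw [mem_unitDisk] at hz; linarith
        refine ENNReal.ofReal_le_ofReal (mul_le_mul_of_nonneg_left (hh z hz) (by positivity))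
    _ ≤ _ := by
        rw [lintegral_const_mul' _ _ ENNReal.ofReal_ne_top]
        gcongr
        refine (lintegral_cauchy_kernel_le hq ha).trans ?_
        gcongr
        exact lintegral_radial_kernel_le (norm_nonneg a) (mem_unitDisk.1 ha) hp hq

/-! ### Test functions -/

/-- The disc automorphism exchanging `0` and `a`. -/
noncomputable def diskInvolution (a z : ℂ) : ℂ := (a - z) / (1 - star a * z)

lemma hasDerivAt_diskInvolution {a z : ℂ} (ha : a ∈ unitDisk) (hz : z ∈ unitDisk) :
    HasDerivAt (diskInvolution a)
      (-((1 - ‖a‖ ^ 2 : ℝ) : ℂ) / (1 - star a * z) ^ 2) z := by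
  have hne := Complex.slitPlane_ne_zero (one_sub_star_mul_mem_slitPlane ha hz)
  have h1 := ((hasDerivAt_id z).const_sub a).div
    (((hasDerivAt_id z).const_mul (star a)).const_sub 1) hne
  convert! h1 using 1
  rw [← one_sub_star_mul_self]
  simp only [id]
  ring

lemma diskInvolution_mem_holDisk {a : ℂ} (ha : a ∈ unitDisk) : diskInvolution a ∈ HolDisk :=
  fun _ hz => (hasDerivAt_diskInvolution ha hz).differentiableAt.differentiableWithinAt

/-- Here the kernel exponent is `2p`: the integral is of order `(1 - |a|)^(-p)`, which the factor
`(1 - |a|²)^p` of `|φ_a'|^p` cancels. -/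
lemma besovEnergy_diskInvolution_le {p : ℝ} (hp : 1 < p) {a : ℂ} (ha : a ∈ unitDisk) :
    besovEnergy p (deriv (diskInvolution a)) ≤ ENNReal.ofReal
      (2 ^ p * (2 * (1 + Real.pi) ^ (2 * p) / (2 * p - 1) * (1 / p + 1 / (p - 1)))) := by
  have hπ := Real.pi_pos
  have hp1 : 0 < p - 1 := by linarith
  have hp2 : 0 < 2 * p - 1 := by linarith
  have ha1 := mem_unitDisk.1 ha
  have hδ : 0 < 1 - ‖a‖ := by linarith
  have hb : 0 ≤ (2 * (1 - ‖a‖)) ^ p := by positivity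
  refine (besovEnergy_le_of_cauchy_kernel hp (q := 2 * p) (by linarith) ha hb fun z hz => ?_).trans ?_
  · rw [(hasDerivAt_diskInvolution ha hz).deriv, norm_div, norm_neg, norm_pow, Complex.norm_real,
      Real.norm_of_nonneg (one_sub_norm_sq_pos ha).le,
      Real.div_rpow (one_sub_norm_sq_pos ha).le (by positivity), div_eq_mul_inv,
      ← Real.rpow_natCast ‖1 - star a * z‖, ← Real.rpow_mul (norm_nonneg _),
      ← Real.rpow_neg (norm_nonneg _), Nat.cast_ofNat]
    gcongr
    · exact (one_sub_norm_sq_pos ha).le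
    · nlinarith [norm_nonneg a]
  · rw [show p - 2 * p - 1 = -p - 1 by ring, show p - 2 * p = -p by ring,
      lintegral_Ioo_one_sub_rpow (norm_nonneg a) ha1 (by linarith)]
    have h1 : 1 ≤ (1 - ‖a‖) ^ (-p) :=
      Real.one_le_rpow_of_pos_of_le_one_of_nonpos hδ (by linarith [norm_nonneg a]) (by linarith)
    have h2 : 0 ≤ ((1 - ‖a‖) ^ (-p) - 1) / p := div_nonneg (by linarith) (by linarith)
    rw [← ENNReal.ofReal_add h2 (by positivity), ← ENNReal.ofReal_mul (by positivity),
      ← ENNReal.ofReal_mul hb]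
    refine ENNReal.ofReal_le_ofReal ?_
    calc _ ≤ (2 * (1 - ‖a‖)) ^ p * (2 * (1 + Real.pi) ^ (2 * p) / (2 * p - 1) *
          ((1 - ‖a‖) ^ (-p) / p + (1 - ‖a‖) ^ (-p) / (p - 1))) := by
          gcongr
          linarith
      _ = (((1 - ‖a‖) ^ p * (1 - ‖a‖) ^ (-p))) * (2 ^ p *
          (2 * (1 + Real.pi) ^ (2 * p) / (2 * p - 1) * (1 / p + 1 / (p - 1)))) := by
          rw [Real.mul_rpow (by norm_num) hδ.le]
          ring
      _ = _ := by
          rw [← Real.rpow_add hδ, add_neg_cancel, Real.rpow_zero, one_mul]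

/-- The logarithmic test functions of `B^p`. -/
noncomputable def logTest (p : ℝ) (a z : ℂ) : ℂ :=
  ((Real.log (2 / (1 - ‖a‖ ^ 2)) ^ (-(1 / p)) : ℝ) : ℂ) *
    (Real.log 2 - Complex.log (1 - star a * z))

lemma hasDerivAt_logTest (p : ℝ) {a z : ℂ} (ha : a ∈ unitDisk) (hz : z ∈ unitDisk) :
    HasDerivAt (logTest p a) (((Real.log (2 / (1 - ‖a‖ ^ 2)) ^ (-(1 / p)) : ℝ) : ℂ) *
      (star a / (1 - star a * z))) z := by
  have h1 := ((((((hasDerivAt_id z).const_mul (star a)).const_sub 1).clog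
    (one_sub_star_mul_mem_slitPlane ha hz)).const_sub (Real.log 2 : ℂ)).const_mul
    ((Real.log (2 / (1 - ‖a‖ ^ 2)) ^ (-(1 / p)) : ℝ) : ℂ))
  convert! h1 using 2
  simp [neg_div]

lemma logTest_mem_holDisk (p : ℝ) {a : ℂ} (ha : a ∈ unitDisk) : logTest p a ∈ HolDisk :=
  fun _ hz => (hasDerivAt_logTest p ha hz).differentiableAt.differentiableWithinAt

lemma log_weight_pos {a : ℂ} (ha : a ∈ unitDisk) : 0 < Real.log (2 / (1 - ‖a‖ ^ 2)) :=
  (Real.log_pos one_lt_two).trans_le (log_weight_bounds ha).1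

lemma norm_logTest_zero_le {p : ℝ} (hp : 0 < p) {a : ℂ} (ha : a ∈ unitDisk) :
    ‖logTest p a 0‖ ≤ Real.log 2 ^ (-(1 / p)) * Real.log 2 := by
  have hl2 : 0 < Real.log 2 := Real.log_pos one_lt_two
  have hL := log_weight_pos ha
  rw [logTest, mul_zero, sub_zero, Complex.log_one, sub_zero, norm_mul, Complex.norm_real,
    Complex.norm_real, Real.norm_of_nonneg hl2.le, Real.norm_of_nonneg (by positivity)]
  gcongr ?_ * _
  refine Real.rpow_le_rpow_of_nonpos hl2 (log_weight_bounds ha).1 ?_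
  rw [neg_nonpos]
  positivity

lemma logTest_self {p q : ℝ} (hpq : p.HolderConjugate q) {a : ℂ} (ha : a ∈ unitDisk) :
    logTest p a a = ((Real.log (2 / (1 - ‖a‖ ^ 2)) ^ (1 / q) : ℝ) : ℂ) := by
  have hL := log_weight_pos ha
  have h1 := one_sub_norm_sq_pos ha
  have h2 : Real.log 2 - Real.log (1 - ‖a‖ ^ 2) = Real.log (2 / (1 - ‖a‖ ^ 2)) :=
    (Real.log_div two_ne_zero h1.ne').symm
  rw [logTest, one_sub_star_mul_self, ← Complex.ofReal_log h1.le, ← Complex.ofReal_sub, h2,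
    ← Complex.ofReal_mul]
  congr 1
  have h3 : 1 / q = -(1 / p) + 1 := by
    have := hpq.inv_add_inv_eq_one
    rw [one_div, one_div]
    linarith
  rw [h3, Real.rpow_add hL, Real.rpow_one]

/-- The kernel exponent is the critical `q = p`, where the integral grows like `log(1/(1 - |a|))`.
The normalization contributes exactly `L⁻¹`, and `L ≥ log 2` absorbs the bounded remainder. -/
lemma besovEnergy_logTest_le {p : ℝ} (hp : 1 < p) {a : ℂ} (ha : a ∈ unitDisk) :
    besovEnergy p (deriv (logTest p a)) ≤ ENNReal.ofReal
      (2 * (1 + Real.pi) ^ p / (p - 1) * (1 + 1 / ((p - 1) * Real.log 2))) := by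
  have hπ := Real.pi_pos
  have hp1 : 0 < p - 1 := by linarith
  have ha1 := mem_unitDisk.1 ha
  have hδ : 0 < 1 - ‖a‖ := by linarith
  have hL := log_weight_pos ha
  have hl2 : 0 < Real.log 2 := Real.log_pos one_lt_two
  obtain ⟨hL1, hL2⟩ := log_weight_bounds ha
  set L := Real.log (2 / (1 - ‖a‖ ^ 2)) with hLdef
  refine (besovEnergy_le_of_cauchy_kernel hp hp ha (b := L⁻¹) (by positivity) fun z hz => ?_).trans ?_
  · have hne := Complex.slitPlane_ne_zero (one_sub_star_mul_mem_slitPlane ha hz)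
    rw [(hasDerivAt_logTest p ha hz).deriv, norm_mul, norm_div, norm_star, Complex.norm_real,
      ← hLdef, Real.norm_of_nonneg (by positivity), Real.mul_rpow (by positivity) (by positivity),
      ← Real.rpow_mul hL.le, neg_mul, one_div_mul_cancel (by linarith), Real.rpow_neg_one,
      Real.div_rpow (by positivity) (by positivity), Real.rpow_neg (norm_nonneg _), div_eq_mul_inv]
    have : ‖a‖ ^ p ≤ 1 := Real.rpow_le_one (norm_nonneg a) ha1.le (by linarith)
    have h0 : 0 ≤ (‖1 - star a * z‖ ^ p)⁻¹ := by positivity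
    gcongr
    nlinarith
  · simp only [sub_self, zero_sub, Real.rpow_neg_one, Real.rpow_zero]
    rw [lintegral_Ioo_one_sub_inv (norm_nonneg a) ha1]
    have h2 : 0 ≤ Real.log (1 / (1 - ‖a‖)) :=
      Real.log_nonneg (by rw [le_div_iff₀ hδ]; linarith [norm_nonneg a])
    rw [← ENNReal.ofReal_add h2 (by positivity), ← ENNReal.ofReal_mul (by positivity),
      ← ENNReal.ofReal_mul (by positivity), mul_left_comm]
    refine ENNReal.ofReal_le_ofReal ?_
    gcongr
    rw [inv_mul_le_iff₀ hL, mul_add, mul_one]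
    gcongr
    rw [mul_one_div, le_div_iff₀ (by positivity)]
    calc 1 / (p - 1) * ((p - 1) * Real.log 2) = Real.log 2 := by field_simp
      _ ≤ L := hL1

/-! ### Necessary and sufficient conditions on the symbol -/

/-- Evaluating at `a` on `φ_a` removes the `A` term, whatever `A` is; this is what makes one
argument serve both `I_g` and `M_g`. -/
lemma norm_bounded_of_besov {p : ℝ} (hp : 1 < p) {A g : ℂ → ℂ}
    (hAB : ∀ f ∈ Besov p, ∃ C, ∀ z ∈ unitDisk,
      ‖A z * f z + ((1 - ‖z‖ ^ 2 : ℝ) : ℂ) * g z * deriv f z‖ ≤ C) :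
    ∃ C, ∀ z ∈ unitDisk, ‖g z‖ ≤ C := by
  obtain ⟨C, hC⟩ := exists_uniform_bound_of_besov hp hAB (ι := unitDisk)
    (F := fun a => diskInvolution a) (fun a => diskInvolution_mem_holDisk a.2) (M := 1)
    (fun a => by simpa [diskInvolution] using (mem_unitDisk.1 a.2).le) ENNReal.ofReal_lt_top
    (fun a => besovEnergy_diskInvolution_le hp a.2)
  refine ⟨C, fun a ha => ?_⟩
  have h := hC ⟨a, ha⟩ a ha
  have h1 : ((1 - ‖a‖ ^ 2 : ℝ) : ℂ) ≠ 0 := Complex.ofReal_ne_zero.2 (one_sub_norm_sq_pos ha).ne'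
  rw [(hasDerivAt_diskInvolution ha ha).deriv, one_sub_star_mul_self] at h
  simp only [diskInvolution, sub_self, zero_div, mul_zero, zero_add] at h
  have h2 : ((1 - ‖a‖ ^ 2 : ℝ) : ℂ) * g a *
      (-((1 - ‖a‖ ^ 2 : ℝ) : ℂ) / ((1 - ‖a‖ ^ 2 : ℝ) : ℂ) ^ 2) = -g a := by
    field_simp
  rwa [h2, norm_neg] at h

/-- Evaluation of `logTest p a` at `a`, where it equals the weight to the power `1/q`. In the
application `g` is the derivative of the symbol. -/
lemma log_weight_bounded_of_besov {p q : ℝ} (hpq : p.HolderConjugate q) {g : ℂ → ℂ}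
    (hA : ∀ f ∈ Besov p, ∃ C, ∀ z ∈ unitDisk, ‖((1 - ‖z‖ ^ 2 : ℝ) : ℂ) * g z * f z‖ ≤ C) :
    ∃ C, ∀ z ∈ unitDisk,
      (1 - ‖z‖ ^ 2) * Real.log (2 / (1 - ‖z‖ ^ 2)) ^ (1 / q) * ‖g z‖ ≤ C := by
  obtain ⟨C, hC⟩ := exists_uniform_bound_of_besov hpq.lt
    (A := fun z => ((1 - ‖z‖ ^ 2 : ℝ) : ℂ) * g z) (B := fun _ => 0)
    (by simpa using hA) (ι := unitDisk)
    (F := fun a => logTest p a) (fun a => logTest_mem_holDisk p a.2)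
    (fun a => norm_logTest_zero_le hpq.pos a.2) ENNReal.ofReal_lt_top
    (fun a => besovEnergy_logTest_le hpq.lt a.2)
  refine ⟨C, fun a ha => ?_⟩
  have h := hC ⟨a, ha⟩ a ha
  have h1 := log_weight_pos ha
  rw [logTest_self hpq ha, zero_mul, add_zero, norm_mul, norm_mul, Complex.norm_real,
    Complex.norm_real, Real.norm_of_nonneg (one_sub_norm_sq_pos ha).le,
    Real.norm_of_nonneg (by positivity)] at h
  linarith

lemma bddAbove_image_unitDisk {u : ℂ → ℝ} :
    BddAbove (u '' unitDisk) ↔ ∃ C, ∀ z ∈ unitDisk, u z ≤ C := by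
  simp only [BddAbove, Set.Nonempty, mem_upperBounds, forall_mem_image]

lemma mem_bloch_iff {f : ℂ → ℂ} (hf : f ∈ HolDisk) :
    f ∈ Bloch ↔ ∃ C, ∀ z ∈ unitDisk, ‖((1 - ‖z‖ ^ 2 : ℝ) : ℂ) * deriv f z‖ ≤ C := by
  rw [Bloch, mem_ofPred_eq, bddAbove_image_unitDisk, and_iff_right hf]
  refine exists_congr fun C => forall₂_congr fun z hz => ?_
  rw [norm_mul, Complex.norm_real, Real.norm_of_nonneg (one_sub_norm_sq_pos hz).le]

lemma deriv_mul_bounded {p : ℝ} (hp : 1 < p) {f g : ℂ → ℂ} (hf : f ∈ Besov p)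
    (hg : g ∈ HInfinity) :
    ∃ C, ∀ z ∈ unitDisk, ‖((1 - ‖z‖ ^ 2 : ℝ) : ℂ) * (g z * deriv f z)‖ ≤ C := by
  obtain ⟨hf, hE⟩ := (mem_besov_iff hp).1 hf
  obtain ⟨D, hD⟩ := one_sub_norm_mul_norm_le hp hE
  obtain ⟨C, hC⟩ := bddAbove_image_unitDisk.1 hg.2
  refine ⟨C * (2 * D), fun z hz => ?_⟩
  have h1 := hD _ (HolDisk.deriv_mem hf) le_rfl z hz
  have h2 := hC z hz
  have hz1 := mem_unitDisk.1 hz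
  rw [norm_mul, norm_mul, Complex.norm_real, Real.norm_of_nonneg (one_sub_norm_sq_pos hz).le]
  calc (1 - ‖z‖ ^ 2) * (‖g z‖ * ‖deriv f z‖)
      = ‖g z‖ * ((1 + ‖z‖) * ((1 - ‖z‖) * ‖deriv f z‖)) := by ring
    _ ≤ C * (2 * D) := by
        have : 0 ≤ 1 - ‖z‖ := by linarith
        have h0 : 0 ≤ (1 - ‖z‖) * ‖deriv f z‖ := by positivity
        have h3 : 0 ≤ C := (norm_nonneg _).trans h2
        gcongr
        linarith

lemma mul_deriv_bounded {p q : ℝ} (hpq : p.HolderConjugate q) {f g : ℂ → ℂ} (hf : f ∈ Besov p)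
    (hg : g ∈ LogBloch (1 / q)) :
    ∃ C, ∀ z ∈ unitDisk, ‖((1 - ‖z‖ ^ 2 : ℝ) : ℂ) * (deriv g z * f z)‖ ≤ C := by
  obtain ⟨D, hD⟩ := norm_le_log_rpow_of_besov hpq hf
  obtain ⟨C, hC⟩ := bddAbove_image_unitDisk.1 hg.2
  refine ⟨C * |D|, fun z hz => ?_⟩
  have h1 := hD z hz
  have h2 := hC z hz
  have hL := log_weight_pos hz
  have h0 := (one_sub_norm_sq_pos hz).le
  rw [norm_mul, norm_mul, Complex.norm_real, Real.norm_of_nonneg h0]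
  calc (1 - ‖z‖ ^ 2) * (‖deriv g z‖ * ‖f z‖)
      ≤ (1 - ‖z‖ ^ 2) * (‖deriv g z‖ *
          (|D| * Real.log (2 / (1 - ‖z‖ ^ 2)) ^ (1 / q))) := by
        gcongr
        exact h1.trans (mul_le_mul_of_nonneg_right (le_abs_self D) (by positivity))
    _ = ((1 - ‖z‖ ^ 2) * Real.log (2 / (1 - ‖z‖ ^ 2)) ^ (1 / q) * ‖deriv g z‖) * |D| := by ring
    _ ≤ C * |D| := mul_le_mul_of_nonneg_right h2 (abs_nonneg D)

lemma companionI_mem_bloch_iff {f g : ℂ → ℂ} (hf : f ∈ HolDisk) (hg : g ∈ HolDisk) :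
    companionI g f ∈ Bloch ↔
      ∃ C, ∀ z ∈ unitDisk, ‖((1 - ‖z‖ ^ 2 : ℝ) : ℂ) * (g z * deriv f z)‖ ≤ C := by
  have h : (fun ξ => g ξ * deriv f ξ) ∈ HolDisk := DifferentiableOn.mul hg (HolDisk.deriv_mem hf)
  rw [companionI, mem_bloch_iff (segmentIntegral_mem_holDisk h)]
  refine exists_congr fun C => forall₂_congr fun z hz => ?_
  rw [(hasDerivAt_segmentIntegral h hz).deriv]

lemma volterraT_mem_bloch_iff {f g : ℂ → ℂ} (hf : f ∈ HolDisk) (hg : g ∈ HolDisk) :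
    volterraT g f ∈ Bloch ↔
      ∃ C, ∀ z ∈ unitDisk, ‖((1 - ‖z‖ ^ 2 : ℝ) : ℂ) * (deriv g z * f z)‖ ≤ C := by
  have h : (fun ξ => deriv g ξ * f ξ) ∈ HolDisk := DifferentiableOn.mul (HolDisk.deriv_mem hg) hf
  rw [volterraT, mem_bloch_iff (segmentIntegral_mem_holDisk h)]
  refine exists_congr fun C => forall₂_congr fun z hz => ?_
  rw [(hasDerivAt_segmentIntegral h hz).deriv]

lemma multM_mem_bloch_iff {f g : ℂ → ℂ} (hf : f ∈ HolDisk) (hg : g ∈ HolDisk) :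
    multM g f ∈ Bloch ↔ ∃ C, ∀ z ∈ unitDisk,
      ‖((1 - ‖z‖ ^ 2 : ℝ) : ℂ) * (deriv g z * f z) +
        ((1 - ‖z‖ ^ 2 : ℝ) : ℂ) * (g z * deriv f z)‖ ≤ C := by
  rw [mem_bloch_iff (f := multM g f) (DifferentiableOn.mul hg hf)]
  refine exists_congr fun C => forall₂_congr fun z hz => ?_
  have hz' := isOpen_unitDisk.mem_nhds hz
  have h := ((DifferentiableOn.differentiableAt hg hz').hasDerivAt.mul
    (DifferentiableOn.differentiableAt hf hz').hasDerivAt).deriv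
  rw [← mul_add, ← h]
  rfl

lemma mapsTo_companionI_iff {p : ℝ} (hp : 1 < p) {g : ℂ → ℂ} (hg : g ∈ HolDisk) :
    MapsTo (companionI g) (Besov p) Bloch ↔ g ∈ HInfinity := by
  constructor
  · intro h
    refine ⟨hg, bddAbove_image_unitDisk.2 (norm_bounded_of_besov hp (A := fun _ => 0) ?_)⟩
    intro f hf
    simpa [mul_assoc] using (companionI_mem_bloch_iff hf.1 hg).1 (h hf)
  · exact fun h f hf => (companionI_mem_bloch_iff hf.1 hg).2 (deriv_mul_bounded hp hf h)

lemma mapsTo_volterraT_iff {p q : ℝ} (hpq : p.HolderConjugate q) {g : ℂ → ℂ} (hg : g ∈ HolDisk) :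
    MapsTo (volterraT g) (Besov p) Bloch ↔ g ∈ LogBloch (1 / q) := by
  constructor
  · intro h
    refine ⟨hg, bddAbove_image_unitDisk.2 (log_weight_bounded_of_besov hpq ?_)⟩
    intro f hf
    simpa only [mul_assoc] using (volterraT_mem_bloch_iff hf.1 hg).1 (h hf)
  · exact fun h f hf => (volterraT_mem_bloch_iff hf.1 hg).2 (mul_deriv_bounded hpq hf h)

lemma mapsTo_multM_iff {p q : ℝ} (hpq : p.HolderConjugate q) {g : ℂ → ℂ} (hg : g ∈ HolDisk) :
    MapsTo (multM g) (Besov p) Bloch ↔ g ∈ HInfinity ∩ LogBloch (1 / q) := by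
  constructor
  · intro h
    have hb : g ∈ HInfinity := by
      refine ⟨hg, bddAbove_image_unitDisk.2 (norm_bounded_of_besov hpq.lt
        (A := fun z => ((1 - ‖z‖ ^ 2 : ℝ) : ℂ) * deriv g z) ?_)⟩
      intro f hf
      simpa only [mul_assoc] using (multM_mem_bloch_iff hf.1 hg).1 (h hf)
    -- With `g` bounded the `g f'` term is under control, so subtracting it reduces to `T_g`.
    refine ⟨hb, (mapsTo_volterraT_iff hpq hg).1 fun f hf => ?_⟩
    obtain ⟨C, hC⟩ := (multM_mem_bloch_iff hf.1 hg).1 (h hf)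
    obtain ⟨D, hD⟩ := deriv_mul_bounded hpq.lt hf hb
    refine (volterraT_mem_bloch_iff hf.1 hg).2 ⟨C + D, fun z hz => ?_⟩
    exact (norm_le_add_norm_add _ _).trans (add_le_add (hC z hz) (hD z hz))
  · rintro ⟨h1, h2⟩ f hf
    obtain ⟨C, hC⟩ := mul_deriv_bounded hpq hf h2
    obtain ⟨D, hD⟩ := deriv_mul_bounded hpq.lt hf h1
    exact (multM_mem_bloch_iff hf.1 hg).2 ⟨C + D, fun z hz =>
      (norm_add_le _ _).trans (add_le_add (hC z hz) (hD z hz))⟩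

theorem mainTheorem5 (p p' : ℝ) (hp : 1 < p) (hpp' : 1 / p + 1 / p' = 1)
    (g : ℂ → ℂ) (hg : g ∈ HolDisk) :
    (MapsTo (companionI g) (Besov p) Bloch ↔ g ∈ HInfinity) ∧
    (MapsTo (multM g) (Besov p) Bloch ↔ g ∈ HInfinity ∩ LogBloch (1 / p')) ∧
    (MapsTo (volterraT g) (Besov p) Bloch ↔ g ∈ LogBloch (1 / p')) := by
  have hpq : p.HolderConjugate p' :=
    Real.holderConjugate_iff.2 ⟨hp, by simpa only [one_div] using hpp'⟩
  exact ⟨mapsTo_companionI_iff hp hg, mapsTo_multM_iff hpq hg, mapsTo_volterraT_iff hpq hg⟩
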